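/- All functions are complex-valued functions on $(0,\infty)$. Let $C_{-1}(0,+\infty)$ be the set of functions of the form $f(t)=t^{p}f_1(t)$, $t>0$, with $p>-1$ and $f_1\in C[0,+\infty)$; let $C_{-1,0}(0,+\infty)$ be defined in the same way with $-1<p<0$; and let $C_{-1}^{q}(0,+\infty)$ be the set of $f\in C_{-1}(0,+\infty)$ with $f^{(q)}\in C_{-1}(0,+\infty)$. Let $(f*g)(t)=\int_0^t f(t-\tau)g(\tau)\,d\tau$, and let $g^{<i>}$, $i\ge 1$, be the $i$-fold convolution power of $g$. Let $n\ge 1$, and let $\kappa\in C_{-1}^{n-1}(0,+\infty)$ and $k\in C_{-1,0}(0,+\infty)$ satisfy $(\kappa*k)(t)=t^{n-1}/(n-1)!$ for $t>0$. Put $$\mathbb{D}_{(k)}f=\frac{d^n}{dt^n}(k*f),\qquad Ff=f-\kappa*(\mathbb{D}_{(k)}f),$$ let $\mathbb{D}_{(k)}^{<p>}$ be the $p$-fold composition of $\mathbb{D}_{(k)}$ with itself ($\mathbb{D}_{(k)}^{<0>}=\mathrm{Id}$), and let $$C^{(m)}_{-1,(k)}(0,+\infty)=\{f\in C_{-1}(0,+\infty):\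 \mathbb{D}_{(k)}^{<i>}f \text{ exists on } (0,\infty) \text{ and belongs to } C_{-1}(0,+\infty),\ i=1,\dots,m\},$$ $$\operatorname{Ker}\mathbb{D}_{(k)}=\{g\in C^{(1)}_{-1,(k)}(0,+\infty):\ \mathbb{D}_{(k)}g=0\}.$$ Let $m\ge 1$, $c_0,\dots,c_m\in\mathbb{C}$ with $c_m\ne 0$, $f\in C_{-1}(0,+\infty)$ and $\gamma_0,\dots,\gamma_{m-1}\in\operatorname{Ker}\mathbb{D}_{(k)}$. Then the Cauchy problem $$\sum_{p=0}^m c_p\,(\mathbb{D}_{(k)}^{<p>}y)(t)=f(t),\qquad (F\,\mathbb{D}_{(k)}^{<p>}y)(t)=\gamma_p(t),\quad p=0,\dots,m-1,\ t>0,$$ has a unique solution $y$ in $C^{(m)}_{-1,(k)}(0,+\infty)$. It is $y=y_f+y_{iv}$, where $$y_f=\sum_{j=1}^{J}\sum_{i=1}^{m_j}c_{ij}\,\bigl(f*l_{\kappa,\lambda_j}^{<i>}\bigr),\qquad y_{iv}=\gamma_0+\sum_{p=0}^{m-1}\sum_{j=1}^{J}\sum_{i=1}^{m_j}c_{ijp}\,\bigl(\gamma_p*l_{\kappa,\lambda_j}^{<i>}\bigr);$$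 $y_f$ is the unique solution of the problem with $\gamma_0=\dots=\gamma_{m-1}=0$, and $y_{iv}$ is the unique solution of the problem with $f=0$. Here, for every $\lambda\in\mathbb{C}$, the series $$l_{\kappa,\lambda}(t)=\sum_{j=1}^{\infty}\lambda^{j-1}\kappa^{<j>}(t)$$ converges for all $t>0$ and defines a function of $C_{-1}(0,+\infty)$; and with $P_m(z)=\sum_{p=0}^m c_pz^p$ and $P_p(z)=\sum_{j=1}^{m-p}c_{p+j}z^j$ for $p=0,\dots,m-1$, the pairwise distinct zeros $\lambda_1,\dots,\lambda_J$ of $P_m$, their multiplicities $m_1,\dots,m_J\ge 1$ (with $\sum_{j=1}^J m_j=m$) and the coefficients $c_{ij}$, $c_{ijp}$ are given by the partial fraction decompositions (which exist) $$\frac{1}{P_m(z)}=\frac{1}{c_m\prod_{j=1}^J(z-\lambda_j)^{m_j}}=\sum_{j=1}^{J}\sum_{i=1}^{m_j}\frac{c_{ij}}{(z-\lambda_j)^i},$$ $$\frac{P_0(z)}{P_m(z)}=1+\sum_{j=1}^{J}\sum_{i=1}^{m_j}\frac{c_{ij0}}{(z-\lambda_j)^i},\qquad \frac{P_p(z)}{P_m(z)}=\sum_{j=1}^{J}\sum_{i=1}^{m_j}\frac{c_{ijp}}{(z-\lambda_j)^i},\quad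 p=1,\dots,m-1.$$ -/

import Mathlib

open Set

noncomputable section

namespace GFD

/- Functions on `(0, ∞)` are represented by functions `ℝ → ℂ`; only their values at `t > 0` matter:
every definition below reads and constrains a function at positive arguments only. -/

/-- The space `C_{-1}(0, ∞)`: functions of the form `t ^ p * f₁ t` for `t > 0`, with `p > -1` and
`f₁` continuous on `[0, ∞)`. -/
def CNegOne : Set (ℝ → ℂ) :=
  {f | ∃ p : ℝ, -1 < p ∧ ∃ f₁ : ℝ → ℂ, ContinuousOn f₁ (Ici 0) ∧
    ∀ t : ℝ, 0 < t → f t = ((t ^ p : ℝ) : ℂ) * f₁ t}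

/-- The space `C_{-1,0}(0, ∞)`: as `C_{-1}(0, ∞)`, with `-1 < p < 0`. -/
def CNegOneZero : Set (ℝ → ℂ) :=
  {f | ∃ p : ℝ, -1 < p ∧ p < 0 ∧ ∃ f₁ : ℝ → ℂ, ContinuousOn f₁ (Ici 0) ∧
    ∀ t : ℝ, 0 < t → f t = ((t ^ p : ℝ) : ℂ) * f₁ t}

/-- The space `C_{-1}^q(0, ∞)`: functions of `C_{-1}(0, ∞)` whose `q`-th derivative exists on
`(0, ∞)` and belongs to `C_{-1}(0, ∞)` (so that this derivative is continuous there). -/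
def CNegOneDeriv (q : ℕ) : Set (ℝ → ℂ) :=
  {f | f ∈ CNegOne ∧ ContDiffOn ℝ q f (Ioi 0) ∧ iteratedDeriv q f ∈ CNegOne}

/-- Laplace convolution `(f * g)(t) = ∫₀ᵗ f(t - τ) g(τ) dτ`. -/
def conv (f g : ℝ → ℂ) : ℝ → ℂ :=
  fun t => ∫ τ in (0 : ℝ)..t, f (t - τ) * g τ

/-- Convolution powers `g^{<m>}`, with `g^{<0>} = 1`, `g^{<1>} = g`. -/
def convPow (g : ℝ → ℂ) : ℕ → ℝ → ℂ
  | 0 => fun _ => 1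
  | 1 => g
  | m + 2 => conv (convPow g (m + 1)) g

/-- The class `𝓛_n` of pairs of kernels: `κ ∈ C_{-1}`, `k ∈ C_{-1,0}` and
`(κ * k)(t) = t ^ (n - 1) / (n - 1)!` for `t > 0`. -/
structure KernelPair (n : ℕ) (κ k : ℝ → ℂ) : Prop where
  left_mem : κ ∈ CNegOne
  right_mem : k ∈ CNegOneZero
  conv_eq : ∀ t : ℝ, 0 < t → conv κ k t = (t : ℂ) ^ (n - 1) / ((n - 1).factorial : ℂ)

/-- The general fractional derivative of Riemann-Liouville type,
`𝔻_{(k)} f = dⁿ/dtⁿ (k * f)`. -/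
def gfd (n : ℕ) (k f : ℝ → ℂ) : ℝ → ℂ :=
  iteratedDeriv n (conv k f)

/-- The `p`-fold sequential derivative `𝔻_{(k)}^{<p>}`; it is the identity for `p = 0`. -/
def seqGfd (n : ℕ) (k : ℝ → ℂ) (p : ℕ) (f : ℝ → ℂ) : ℝ → ℂ :=
  (gfd n k)^[p] f

/-- The space `C_{-1,(k)}^{(m)}(0, ∞)`: functions of `C_{-1}` for which `𝔻_{(k)}^{<i>} f` exists
on `(0, ∞)` and belongs to `C_{-1}` for `i = 1, …, m`. -/
def GfdSpace (n : ℕ) (k : ℝ → ℂ) (m : ℕ) : Set (ℝ → ℂ) :=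
  {f | f ∈ CNegOne ∧ ∀ i < m, ContDiffOn ℝ n (conv k (seqGfd n k i f)) (Ioi 0) ∧
    seqGfd n k (i + 1) f ∈ CNegOne}

/-- The null space of `𝔻_{(k)}` on `C_{-1,(k)}^{(1)}(0, ∞)`. -/
def gfdKer (n : ℕ) (k : ℝ → ℂ) : Set (ℝ → ℂ) :=
  {g | g ∈ GfdSpace n k 1 ∧ ∀ t : ℝ, 0 < t → gfd n k g t = 0}

/-- The projector `F f = f - κ * 𝔻_{(k)} f`. -/
def proj (n : ℕ) (κ k f : ℝ → ℂ) : ℝ → ℂ :=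
  fun t => f t - conv κ (gfd n k f) t

/-- `y` solves `∑_{p=0}^m c_p 𝔻_{(k)}^{<p>} y = f` with the initial conditions
`F 𝔻_{(k)}^{<p>} y = γ_p`, `p = 0, …, m - 1`, in the space `C_{-1,(k)}^{(m)}(0, ∞)`. -/
structure IsSolution (n m : ℕ) (κ k : ℝ → ℂ) (c : ℕ → ℂ) (f : ℝ → ℂ) (γ : ℕ → ℝ → ℂ)
    (y : ℝ → ℂ) : Prop where
  mem : y ∈ GfdSpace n k m
  equation : ∀ t : ℝ, 0 < t → ∑ p ∈ Finset.range (m + 1), c p * seqGfd n k p y t = f t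
  initial : ∀ p < m, ∀ t : ℝ, 0 < t → proj n κ k (seqGfd n k p y) t = γ p t

/-- `y` is a solution, and every solution agrees with `y` on `(0, ∞)`. -/
def IsUniqueSolution (n m : ℕ) (κ k : ℝ → ℂ) (c : ℕ → ℂ) (f : ℝ → ℂ) (γ : ℕ → ℝ → ℂ)
    (y : ℝ → ℂ) : Prop :=
  IsSolution n m κ k c f γ y ∧
    ∀ y' : ℝ → ℂ, IsSolution n m κ k c f γ y' → ∀ t : ℝ, 0 < t → y' t = y t

/-- The convolution series `l_{κ,z}(t) = ∑_{j ≥ 1} z ^ (j - 1) κ^{<j>}(t)`. -/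
def convSeries (κ : ℝ → ℂ) (z : ℂ) : ℝ → ℂ :=
  fun t => ∑' j : ℕ, z ^ j * convPow κ (j + 1) t

/-- The polynomial `P_m(z) = ∑_{p=0}^m c_p z ^ p`. -/
def charPoly (c : ℕ → ℂ) (m : ℕ) (z : ℂ) : ℂ :=
  ∑ p ∈ Finset.range (m + 1), c p * z ^ p

/-- The polynomial `P_p(z) = ∑_{j=1}^{m-p} c_{p+j} z ^ j`. -/
def initPoly (c : ℕ → ℂ) (m p : ℕ) (z : ℂ) : ℂ :=
  ∑ j ∈ Finset.Icc 1 (m - p), c (p + j) * z ^ j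

/-- `P_m` has exactly the distinct zeros `r j` with the multiplicities `μ j`, and the numbers `a j i`
and `b p j i` (`1 ≤ i ≤ μ j`, `p < m`) are the coefficients in the partial fraction decompositions of
`1 / P_m` and of `P_p / P_m`. -/
structure IsPartialFractions (c : ℕ → ℂ) (m J : ℕ) (r : Fin J → ℂ) (μ : Fin J → ℕ)
    (a : Fin J → ℕ → ℂ) (b : ℕ → Fin J → ℕ → ℂ) : Prop where
  distinct : Function.Injective r
  mult_pos : ∀ j, 1 ≤ μ j
  mult_sum : ∑ j, μ j = m
  factor : ∀ z : ℂ, charPoly c m z = c m * ∏ j, (z - r j) ^ μ j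
  inv_eq : ∀ z : ℂ, charPoly c m z ≠ 0 →
    1 / charPoly c m z = ∑ j, ∑ i ∈ Finset.Icc 1 (μ j), a j i / (z - r j) ^ i
  zero_eq : ∀ z : ℂ, charPoly c m z ≠ 0 →
    initPoly c m 0 z / charPoly c m z =
      1 + ∑ j, ∑ i ∈ Finset.Icc 1 (μ j), b 0 j i / (z - r j) ^ i
  pos_eq : ∀ p : ℕ, 1 ≤ p → p < m → ∀ z : ℂ, charPoly c m z ≠ 0 →
    initPoly c m p z / charPoly c m z =
      ∑ j, ∑ i ∈ Finset.Icc 1 (μ j), b p j i / (z - r j) ^ i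

/-- `y_f = ∑_j ∑_{i=1}^{μ_j} a_{ij} (f * l_{κ,r_j}^{<i>})`. -/
def sourceSol (κ : ℝ → ℂ) (J : ℕ) (r : Fin J → ℂ) (μ : Fin J → ℕ) (a : Fin J → ℕ → ℂ)
    (f : ℝ → ℂ) : ℝ → ℂ :=
  fun t => ∑ j, ∑ i ∈ Finset.Icc 1 (μ j), a j i * conv f (convPow (convSeries κ (r j)) i) t

/-- `y_iv = γ_0 + ∑_{p<m} ∑_j ∑_{i=1}^{μ_j} b_{ijp} (γ_p * l_{κ,r_j}^{<i>})`. -/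
def initSol (κ : ℝ → ℂ) (m J : ℕ) (r : Fin J → ℂ) (μ : Fin J → ℕ) (b : ℕ → Fin J → ℕ → ℂ)
    (γ : ℕ → ℝ → ℂ) : ℝ → ℂ :=
  fun t => γ 0 t + ∑ p ∈ Finset.range m, ∑ j, ∑ i ∈ Finset.Icc 1 (μ j),
    b p j i * conv (γ p) (convPow (convSeries κ (r j)) i) t

end GFD

end

/-! On functions on `(0, ∞)`, `C_{-1}` is a commutative ring without unit under convolution; adjoin
a unit and write `x` for the class of `κ`. Since `k * κ` is the kernel of `n`-fold integration,
`𝔻_{(k)} (κ * f) = f` (`KernelPair.hasGfd_conv`). The condition `F 𝔻^{<p>} y = γ_p` says that `Y p =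
𝔻^{<p>} y` satisfies `Y p = x * Y (p + 1) + Γ p`; conversely, since `𝔻_{(k)} γ_p = 0`, such a
relation forces `𝔻_{(k)} (Y p) = Y (p + 1)`. So the Cauchy problem is the algebraic problem of
finding a chain with `∑ c_p Y p = Φ` (`isSolution_iff`).

Multiplying this equation by `x ^ m` and unrolling the chain gives `Q(x) * Y 0 = x ^ m * Φ + ∑
Q_p(x) * Γ p`, where `Q(w) = w ^ m P_m(1 / w)` and `Q_p(w) = w ^ m P_p(1 / w)` are polynomials
(`aeval_revPoly_mul_chain`). Here `Q(x) = c_m ∏ (1 - λ_j x) ^ m_j`. The series `l_{κ,λ}` satisfies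
`l * (1 - λ x) = x`, so `1 - λ x` has the inverse `1 + λ l` and `Q(x)` is a unit: this gives
uniqueness, and existence by solving for the last entry of the chain (`exists_chain`).

For the formula, `l_{κ,λ} = x / (1 - λ x)` plays the role of `1 / (z - λ)` with `z = 1 / x`. As `x`
is not assumed invertible, the partial fractions are first multiplied out to polynomial identities
in `w = 1 / z`; these may be evaluated at `x` (`aeval_revPoly_mul`).

The analytic input is closure and associativity of convolution on `C_{-1}`, the convergence of
`l_{κ,λ}` from Beta-integral bounds on convolution powers, and the fundamental theorem of calculus.
-/

noncomputable section

namespace GFD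

/-! ### The space `C_{-1}` and its stability under convolution. -/

section Spaces

open MeasureTheory Filter Topology

/-- `f` agrees on `(0, ∞)` with `t ^ p` times a continuous function. -/
def HasOrder (p : ℝ) (f : ℝ → ℂ) : Prop :=
  ∃ f₁ : ℝ → ℂ, Continuous f₁ ∧ ∀ t : ℝ, 0 < t → f t = ((t ^ p : ℝ) : ℂ) * f₁ t

/-- Freezing the factor at its value at `0` for negative arguments makes it continuous on all of
`ℝ`, so later continuity proofs need no domain conditions. -/
theorem hasOrder_of_continuousOn {p : ℝ} {f f₁ : ℝ → ℂ} (h : ContinuousOn f₁ (Ici 0))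
    (hf : ∀ t : ℝ, 0 < t → f t = ((t ^ p : ℝ) : ℂ) * f₁ t) : HasOrder p f := by
  refine ⟨fun t => f₁ (max t 0), ?_, fun t ht => ?_⟩
  · exact h.comp_continuous (by fun_prop) fun t => mem_Ici.2 (le_max_right _ _)
  · beta_reduce
    rw [max_eq_left ht.le, hf t ht]

theorem mem_CNegOne_iff {f : ℝ → ℂ} : f ∈ CNegOne ↔ ∃ p : ℝ, -1 < p ∧ HasOrder p f := by
  constructor
  · rintro ⟨p, hp, f₁, h₁, h⟩
    exact ⟨p, hp, hasOrder_of_continuousOn h₁ h⟩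
  · rintro ⟨p, hp, f₁, h₁, h⟩
    exact ⟨p, hp, f₁, h₁.continuousOn, h⟩

theorem HasOrder.mem {p : ℝ} {f : ℝ → ℂ} (h : HasOrder p f) (hp : -1 < p) : f ∈ CNegOne :=
  mem_CNegOne_iff.2 ⟨p, hp, h⟩

theorem HasOrder.congr {p : ℝ} {f g : ℝ → ℂ} (h : HasOrder p f) (hfg : ∀ t, 0 < t → g t = f t) :
    HasOrder p g := by
  obtain ⟨f₁, h₁, h⟩ := h
  exact ⟨f₁, h₁, fun t ht => (hfg t ht).trans (h t ht)⟩

/-- The surplus `t ^ (p - q)` has a nonnegative exponent, hence is continuous at `0` and can be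
moved into the regular factor. This brings two functions to a common exponent. -/
theorem HasOrder.mono {p q : ℝ} {f : ℝ → ℂ} (h : HasOrder p f) (hq : q ≤ p) : HasOrder q f := by
  obtain ⟨f₁, h₁, h⟩ := h
  refine ⟨fun t => ((t ^ (p - q) : ℝ) : ℂ) * f₁ t, ?_, fun t ht => ?_⟩
  · have := Real.continuous_rpow_const (sub_nonneg.2 hq)
    fun_prop
  · rw [h t ht, ← mul_assoc, ← Complex.ofReal_mul, ← Real.rpow_add ht, add_sub_cancel]

theorem HasOrder.add {p : ℝ} {f g : ℝ → ℂ} (hf : HasOrder p f) (hg : HasOrder p g) :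
    HasOrder p (fun t => f t + g t) := by
  obtain ⟨f₁, hf₁, hf⟩ := hf
  obtain ⟨g₁, hg₁, hg⟩ := hg
  exact ⟨fun t => f₁ t + g₁ t, by fun_prop, fun t ht => by
    beta_reduce; rw [hf t ht, hg t ht, mul_add]⟩

theorem HasOrder.const_mul {p : ℝ} {f : ℝ → ℂ} (hf : HasOrder p f) (a : ℂ) :
    HasOrder p (fun t => a * f t) := by
  obtain ⟨f₁, hf₁, hf⟩ := hf
  exact ⟨fun t => a * f₁ t, by fun_prop, fun t ht => by beta_reduce; rw [hf t ht, mul_left_comm]⟩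

theorem HasOrder.continuousOn {p : ℝ} {f : ℝ → ℂ} (hf : HasOrder p f) :
    ContinuousOn f (Ioi 0) := by
  obtain ⟨f₁, hf₁, hf⟩ := hf
  refine ContinuousOn.congr (f := fun t => ((t ^ p : ℝ) : ℂ) * f₁ t) ?_ fun t ht => hf t ht
  refine ContinuousOn.mul (Complex.continuous_ofReal.comp_continuousOn fun t ht => ?_)
    hf₁.continuousOn
  exact (Real.continuousAt_rpow_const t p (Or.inl (ne_of_gt ht))).continuousWithinAt

theorem HasOrder.exists_bound {p : ℝ} {f : ℝ → ℂ} (hf : HasOrder p f) (T : ℝ) :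
    ∃ M : ℝ, 0 < M ∧ ∀ t, 0 < t → t ≤ T → ‖f t‖ ≤ M * t ^ p := by
  obtain ⟨f₁, hf₁, hf⟩ := hf
  obtain ⟨M, hM⟩ := (isCompact_Icc (a := (0:ℝ)) (b := T)).exists_bound_of_continuousOn
    hf₁.continuousOn
  refine ⟨max M 1, by positivity, fun t ht htT => ?_⟩
  rw [hf t ht, norm_mul, Complex.norm_real, Real.norm_of_nonneg (by positivity), mul_comm]
  gcongr
  exact (hM t ⟨ht.le, htT⟩).trans (le_max_left _ _)

theorem CNegOne.continuousOn {f : ℝ → ℂ} (hf : f ∈ CNegOne) : ContinuousOn f (Ioi 0) := by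
  obtain ⟨p, -, h⟩ := mem_CNegOne_iff.1 hf
  exact h.continuousOn

theorem CNegOne.congr {f g : ℝ → ℂ} (hf : f ∈ CNegOne) (hfg : ∀ t, 0 < t → g t = f t) :
    g ∈ CNegOne := by
  obtain ⟨p, hp, h⟩ := mem_CNegOne_iff.1 hf
  exact (h.congr hfg).mem hp

theorem CNegOne.add {f g : ℝ → ℂ} (hf : f ∈ CNegOne) (hg : g ∈ CNegOne) :
    (fun t => f t + g t) ∈ CNegOne := by
  obtain ⟨p, hp, hf⟩ := mem_CNegOne_iff.1 hf
  obtain ⟨q, hq, hg⟩ := mem_CNegOne_iff.1 hg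
  exact ((hf.mono (min_le_left p q)).add (hg.mono (min_le_right p q))).mem (lt_min hp hq)

theorem CNegOne.const_mul {f : ℝ → ℂ} (hf : f ∈ CNegOne) (a : ℂ) :
    (fun t => a * f t) ∈ CNegOne := by
  obtain ⟨p, hp, hf⟩ := mem_CNegOne_iff.1 hf
  exact (hf.const_mul a).mem hp

theorem zero_mem_CNegOne : (fun _ => 0 : ℝ → ℂ) ∈ CNegOne :=
  ⟨0, by norm_num, fun _ => 0, continuousOn_const, fun t _ => by simp⟩

/-- The Beta integral over `(0, t)`: integrability. -/
theorem intervalIntegrable_beta {p q t : ℝ} (hp : -1 < p) (hq : -1 < q) (ht : 0 < t) :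
    IntervalIntegrable (fun τ : ℝ => (t - τ) ^ p * τ ^ q) volume 0 t := by
  have h := Complex.betaIntegral_convergent (u := ((q + 1 : ℝ) : ℂ)) (v := ((p + 1 : ℝ) : ℂ))
    (by simp; linarith) (by simp; linarith)
  have h1 : IntervalIntegrable (fun x : ℝ => (1 - x) ^ p * x ^ q) volume 0 1 := by
    -- The norm of the complex Beta integrand is the real one. Only the open interval is compared,
    -- which avoids powers of `0` at the endpoints; scaling by `t` then moves from `(0, 1)` to `(0,
    -- t)`.
    refine (h.norm).congr_uIoo fun x hx => ?_
    rw [uIoo_of_le zero_le_one] at hx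
    have hx1 : 0 < 1 - x := by linarith [hx.2]
    have e : (1 - (x : ℂ)) = ((1 - x : ℝ) : ℂ) := by push_cast; ring
    simp only [norm_mul]
    rw [e, Complex.norm_cpow_eq_rpow_re_of_pos hx.1, Complex.norm_cpow_eq_rpow_re_of_pos hx1,
      mul_comm]
    simp
  have h2 := (h1.comp_mul_left (c := t⁻¹)).const_mul (t ^ p * t ^ q)
  rw [zero_div, div_inv_eq_mul, one_mul] at h2
  refine h2.congr_uIoo fun x hx => ?_
  rw [uIoo_of_le ht.le] at hx
  have e1 : 1 - t⁻¹ * x = (t - x) / t := by field_simp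
  have e2 : t⁻¹ * x = x / t := by field_simp
  have hx1 : 0 < t - x := by linarith [hx.2]
  have := Real.rpow_pos_of_pos ht p
  have := Real.rpow_pos_of_pos ht q
  beta_reduce
  rw [e1, e2, Real.div_rpow hx1.le ht.le, Real.div_rpow hx.1.le ht.le]
  field_simp

theorem intervalIntegrable_beta_mul {p q t : ℝ} (hp : -1 < p) (hq : -1 < q) (ht : 0 < t)
    {F : ℝ → ℂ} (hF : Continuous F) :
    IntervalIntegrable (fun τ : ℝ => (((t - τ) ^ p * τ ^ q : ℝ) : ℂ) * F τ) volume 0 t := by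
  have h := intervalIntegrable_beta hp hq ht
  refine IntervalIntegrable.mul_continuousOn (f := fun τ : ℝ => (((t - τ) ^ p * τ ^ q : ℝ) : ℂ))
    ?_ hF.continuousOn
  rw [intervalIntegrable_iff] at h ⊢
  exact h.ofReal

theorem integral_beta {p q t : ℝ} (hp : -1 < p) (hq : -1 < q) (ht : 0 < t) :
    ∫ τ in (0:ℝ)..t, (t - τ) ^ p * τ ^ q =
      t ^ (p + q + 1) * (Real.Gamma (p + 1) * Real.Gamma (q + 1) / Real.Gamma (p + q + 2)) := by
  have h := Complex.betaIntegral_scaled ((q + 1 : ℝ) : ℂ) ((p + 1 : ℝ) : ℂ) ht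
  rw [Complex.betaIntegral_eq_Gamma_mul_div _ _ (by simp; linarith) (by simp; linarith)] at h
  have e : ∀ x ∈ Ioo 0 t, (x : ℂ) ^ (((q + 1 : ℝ) : ℂ) - 1) *
      ((t : ℂ) - x) ^ (((p + 1 : ℝ) : ℂ) - 1) = (((t - x) ^ p * x ^ q : ℝ) : ℂ) := by
    intro x hx
    have hx1 : 0 < t - x := by linarith [hx.2]
    rw [show ((q + 1 : ℝ) : ℂ) - 1 = ((q : ℝ) : ℂ) by push_cast; ring,
      show ((p + 1 : ℝ) : ℂ) - 1 = ((p : ℝ) : ℂ) by push_cast; ring, ← Complex.ofReal_sub,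
      ← Complex.ofReal_cpow hx.1.le, ← Complex.ofReal_cpow hx1.le]
    push_cast; ring
  rw [intervalIntegral.integral_congr_Ioo_of_le ht.le e, intervalIntegral.integral_ofReal,
    ← Complex.ofReal_add, Complex.Gamma_ofReal, Complex.Gamma_ofReal, Complex.Gamma_ofReal,
    show (((q + 1 + (p + 1) : ℝ) : ℂ) - 1) = ((p + q + 1 : ℝ) : ℂ) by push_cast; ring,
    ← Complex.ofReal_cpow ht.le, ← Complex.ofReal_mul, ← Complex.ofReal_div,
    ← Complex.ofReal_mul, Complex.ofReal_inj] at h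
  rw [h, mul_comm (Real.Gamma (q + 1)), show q + 1 + (p + 1) = p + q + 2 by ring]

theorem conv_congr {f f' g g' : ℝ → ℂ} (hf : ∀ t, 0 < t → f t = f' t)
    (hg : ∀ t, 0 < t → g t = g' t) {t : ℝ} (ht : 0 < t) : conv f g t = conv f' g' t := by
  refine intervalIntegral.integral_congr_Ioo_of_le ht.le fun x hx => ?_
  simp only [hf _ (sub_pos.2 hx.2), hg _ hx.1]

theorem conv_comm (f g : ℝ → ℂ) (t : ℝ) : conv f g t = conv g f t := by
  have := intervalIntegral.integral_comp_sub_left (fun τ => f (t - τ) * g τ) (a := 0) (b := t) t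
  simp only [sub_sub_cancel, sub_self, sub_zero] at this
  rw [conv, ← this, conv]
  simp only [mul_comm]

theorem HasOrder.norm {p : ℝ} {f : ℝ → ℂ} (hf : HasOrder p f) :
    HasOrder p (fun t => ((‖f t‖ : ℝ) : ℂ)) := by
  obtain ⟨f₁, h₁, h⟩ := hf
  refine ⟨fun t => ((‖f₁ t‖ : ℝ) : ℂ), by fun_prop, fun t ht => ?_⟩
  beta_reduce
  rw [h t ht, norm_mul, Complex.norm_real, Real.norm_of_nonneg (by positivity)]
  push_cast; rfl

theorem HasOrder.intervalIntegrable_conv {p q : ℝ} {f g : ℝ → ℂ} (hf : HasOrder p f)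
    (hg : HasOrder q g) (hp : -1 < p) (hq : -1 < q) {t : ℝ} (ht : 0 < t) :
    IntervalIntegrable (fun τ => f (t - τ) * g τ) volume 0 t := by
  obtain ⟨f₁, hf₁, hf⟩ := hf
  obtain ⟨g₁, hg₁, hg⟩ := hg
  have h2 := intervalIntegrable_beta_mul hp hq ht (F := fun τ => f₁ (t - τ) * g₁ τ) (by fun_prop)
  refine h2.congr_uIoo fun x hx => ?_
  rw [uIoo_of_le ht.le] at hx
  simp only [hf _ (sub_pos.2 hx.2), hg _ hx.1]
  push_cast
  ring

/-- The regular factor of a convolution. -/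
def convFactor (p q : ℝ) (f₁ g₁ : ℝ → ℂ) (t : ℝ) : ℂ :=
  ∫ x in (0:ℝ)..1, (((1 - x) ^ p * x ^ q : ℝ) : ℂ) * (f₁ (t * (1 - x)) * g₁ (t * x))

theorem continuous_convFactor {p q : ℝ} (hp : -1 < p) (hq : -1 < q) {f₁ g₁ : ℝ → ℂ}
    (hf : Continuous f₁) (hg : Continuous g₁) : Continuous (convFactor p q f₁ g₁) := by
  have hβ := intervalIntegrable_beta hp hq one_pos
  rw [continuous_iff_continuousAt]
  intro t₀
  have hK : IsCompact (Icc (t₀ - 1) (t₀ + 1) ×ˢ Icc (0:ℝ) 1) := isCompact_Icc.prod isCompact_Icc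
  obtain ⟨M, hM⟩ := hK.exists_bound_of_continuousOn
    (f := fun z : ℝ × ℝ => f₁ (z.1 * (1 - z.2)) * g₁ (z.1 * z.2)) (by fun_prop)
  refine intervalIntegral.continuousAt_of_dominated_interval
    (bound := fun x => ‖(1 - x) ^ p * x ^ q‖ * M) ?_ ?_ (hβ.norm.mul_const M) ?_
  · refine Eventually.of_forall fun t => ?_
    have h2 := intervalIntegrable_beta_mul hp hq one_pos
      (F := fun x => f₁ (t * (1 - x)) * g₁ (t * x)) (by fun_prop)
    rw [uIoc_of_le zero_le_one]
    exact h2.1.aestronglyMeasurable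
  · filter_upwards [Icc_mem_nhds (show t₀ - 1 < t₀ by linarith) (show t₀ < t₀ + 1 by linarith)]
      with t ht
    refine Eventually.of_forall fun x hx => ?_
    rw [uIoc_of_le zero_le_one] at hx
    rw [norm_mul, Complex.norm_real]
    gcongr
    exact hM (t, x) ⟨ht, hx.1.le, hx.2⟩
  · refine Eventually.of_forall fun x _ => ?_
    fun_prop

/-- The substitution `τ = t x` moves the integral to the fixed interval `[0, 1]` and extracts `t ^
(p + q + 1)`; what remains is continuous up to `0` by dominated convergence. -/
theorem conv_eq_convFactor {p q : ℝ} {f g f₁ g₁ : ℝ → ℂ}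
    (hf : ∀ t : ℝ, 0 < t → f t = ((t ^ p : ℝ) : ℂ) * f₁ t)
    (hg : ∀ t : ℝ, 0 < t → g t = ((t ^ q : ℝ) : ℂ) * g₁ t) {t : ℝ} (ht : 0 < t) :
    conv f g t = ((t ^ (p + q + 1) : ℝ) : ℂ) * convFactor p q f₁ g₁ t := by
  have h := intervalIntegral.smul_integral_comp_mul_left (fun τ => f (t - τ) * g τ) t
    (a := 0) (b := 1)
  rw [mul_zero, mul_one] at h
  rw [conv, ← h, convFactor, Real.rpow_add ht, Real.rpow_add ht, Real.rpow_one,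
    ← intervalIntegral.integral_const_mul, ← intervalIntegral.integral_smul]
  refine intervalIntegral.integral_congr_Ioo_of_le zero_le_one fun x hx => ?_
  have hx1 : 0 < 1 - x := by linarith [hx.2]
  have e : t - t * x = t * (1 - x) := by ring
  rw [e, hf _ (mul_pos ht hx1), hg _ (mul_pos ht hx.1), Real.mul_rpow ht.le hx1.le,
    Real.mul_rpow ht.le hx.1.le, Complex.real_smul]
  push_cast
  ring

theorem HasOrder.conv {p q : ℝ} {f g : ℝ → ℂ} (hf : HasOrder p f) (hg : HasOrder q g)
    (hp : -1 < p) (hq : -1 < q) : HasOrder (p + q + 1) (conv f g) := by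
  obtain ⟨f₁, hf₁, hf⟩ := hf
  obtain ⟨g₁, hg₁, hg⟩ := hg
  exact ⟨_, continuous_convFactor hp hq hf₁ hg₁, fun t ht => conv_eq_convFactor hf hg ht⟩

theorem norm_conv_le {p q M N t : ℝ} {f g : ℝ → ℂ} (hp : -1 < p) (hq : -1 < q) (ht : 0 < t)
    (hM : 0 ≤ M)
    (hf : ∀ s, 0 < s → s ≤ t → ‖f s‖ ≤ M * s ^ p) (hg : ∀ s, 0 < s → s ≤ t → ‖g s‖ ≤ N * s ^ q) :
    ‖conv f g t‖ ≤ M * N * (t ^ (p + q + 1) *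
      (Real.Gamma (p + 1) * Real.Gamma (q + 1) / Real.Gamma (p + q + 2))) := by
  rw [← integral_beta hp hq ht, ← intervalIntegral.integral_const_mul]
  refine intervalIntegral.norm_integral_le_of_norm_le ht.le ?_
    ((intervalIntegrable_beta hp hq ht).const_mul _)
  have : ∀ᵐ x : ℝ, x ≠ t := by simp [ae_iff]
  filter_upwards [this] with x hxt hx
  have hx1 : 0 < t - x := sub_pos.2 (lt_of_le_of_ne hx.2 hxt)
  rw [norm_mul]
  calc ‖f (t - x)‖ * ‖g x‖ ≤ (M * (t - x) ^ p) * (N * x ^ q) := by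
        gcongr
        · exact hf _ hx1 (by linarith [hx.1])
        · exact hg _ hx.1 hx.2
    _ = _ := by ring

theorem CNegOne.conv {f g : ℝ → ℂ} (hf : f ∈ CNegOne) (hg : g ∈ CNegOne) : conv f g ∈ CNegOne := by
  obtain ⟨p, hp, hf⟩ := mem_CNegOne_iff.1 hf
  obtain ⟨q, hq, hg⟩ := mem_CNegOne_iff.1 hg
  exact (hf.conv hg hp hq).mem (by linarith)

theorem CNegOne.intervalIntegrable_conv {f g : ℝ → ℂ} (hf : f ∈ CNegOne) (hg : g ∈ CNegOne)
    {t : ℝ} (ht : 0 < t) : IntervalIntegrable (fun τ => f (t - τ) * g τ) volume 0 t := by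
  obtain ⟨p, hp, hf⟩ := mem_CNegOne_iff.1 hf
  obtain ⟨q, hq, hg⟩ := mem_CNegOne_iff.1 hg
  exact hf.intervalIntegrable_conv hg hp hq ht

theorem conv_add {f g h : ℝ → ℂ} (hf : f ∈ CNegOne) (hg : g ∈ CNegOne) (hh : h ∈ CNegOne)
    {t : ℝ} (ht : 0 < t) : conv f (fun s => g s + h s) t = conv f g t + conv f h t := by
  rw [GFD.conv, GFD.conv, GFD.conv, ← intervalIntegral.integral_add
    (CNegOne.intervalIntegrable_conv hf hg ht) (CNegOne.intervalIntegrable_conv hf hh ht)]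
  simp only [mul_add]

theorem conv_const_mul (f g : ℝ → ℂ) (a : ℂ) (t : ℝ) :
    conv f (fun s => a * g s) t = a * conv f g t := by
  rw [conv, conv, ← intervalIntegral.integral_const_mul]
  simp only [mul_left_comm]

end Spaces

/-! ### `C_{-1}` as a commutative algebra under convolution. -/

section ConvolutionAlgebra

open MeasureTheory Filter Topology ContinuousLinearMap Convolution

/-- Extension by zero from `(0, ∞)` to `ℝ`. -/
def zeroExt (f : ℝ → ℂ) : ℝ → ℂ := indicator (Ioi 0) f

theorem zeroExt_of_pos (f : ℝ → ℂ) {t : ℝ} (ht : 0 < t) : zeroExt f t = f t :=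
  indicator_of_mem (mem_Ioi.2 ht) f

theorem zeroExt_of_nonpos (f : ℝ → ℂ) {t : ℝ} (ht : t ≤ 0) : zeroExt f t = 0 :=
  indicator_of_notMem (fun h => not_lt.2 ht (mem_Ioi.1 h)) f

theorem CNegOne.zeroExt {f : ℝ → ℂ} (hf : f ∈ CNegOne) : zeroExt f ∈ CNegOne :=
  CNegOne.congr hf fun _ ht => zeroExt_of_pos f ht

theorem convolution_zeroExt (f g : ℝ → ℂ) :
    (zeroExt f ⋆[mul ℝ ℂ, volume] zeroExt g) = zeroExt (conv f g) := by
  have h := posConvolution_eq_convolution_indicator f g (mul ℝ ℂ) volume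
  rw [zeroExt, zeroExt, ← h, zeroExt, posConvolution]
  congr 1
  funext t
  rw [conv_comm, conv]
  simp only [mul_apply', mul_comm]

theorem CNegOne.convolutionExistsAt {f g : ℝ → ℂ} (hf : f ∈ CNegOne) (hg : g ∈ CNegOne) (x : ℝ) :
    ConvolutionExistsAt (GFD.zeroExt f) (GFD.zeroExt g) x (mul ℝ ℂ) volume := by
  rw [ConvolutionExistsAt]
  rcases le_or_gt x 0 with hx | hx
  · refine (integrable_zero ℝ ℂ volume).congr (Eventually.of_forall fun t => ?_)
    beta_reduce
    rcases le_or_gt t 0 with ht | ht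
    · simp [zeroExt_of_nonpos _ ht]
    · simp [zeroExt_of_nonpos g (show x - t ≤ 0 by linarith)]
  · have h := (CNegOne.intervalIntegrable_conv hg hf hx).1
    rw [integrableOn_Ioc_iff_integrableOn_Ioo, ← integrable_indicator_iff measurableSet_Ioo] at h
    refine h.congr (Eventually.of_forall fun t => ?_)
    by_cases ht : t ∈ Ioo 0 x
    · beta_reduce
      rw [indicator_of_mem ht, zeroExt_of_pos _ ht.1, zeroExt_of_pos _ (sub_pos.2 ht.2),
        mul_apply', mul_comm]
    · rw [indicator_of_notMem ht]
      rcases le_or_gt t 0 with h0 | h0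
      · simp [zeroExt_of_nonpos _ h0]
      · have : x - t ≤ 0 := by
          by_contra h1
          exact ht ⟨h0, by linarith⟩
        simp [zeroExt_of_nonpos g this]

theorem CNegOne.norm {f : ℝ → ℂ} (hf : f ∈ CNegOne) : (fun t => ((‖f t‖ : ℝ) : ℂ)) ∈ CNegOne := by
  obtain ⟨p, hp, hf⟩ := mem_CNegOne_iff.1 hf
  exact hf.norm.mem hp

theorem CNegOne.convolutionExistsAt_norm {f g : ℝ → ℂ} (hf : f ∈ CNegOne) (hg : g ∈ CNegOne)
    (x : ℝ) : ConvolutionExistsAt (fun t => ‖GFD.zeroExt f t‖) (fun t => ‖GFD.zeroExt g t‖) x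
      (mul ℝ ℝ) volume := by
  have h := (CNegOne.convolutionExistsAt hf hg x).norm
  simpa only [ConvolutionExistsAt, mul_apply', norm_mul] using h

theorem CNegOne.aestronglyMeasurable_zeroExt {f : ℝ → ℂ} (hf : f ∈ CNegOne) :
    AEStronglyMeasurable (GFD.zeroExt f) volume :=
  (aestronglyMeasurable_indicator_iff measurableSet_Ioi).2
    ((CNegOne.continuousOn hf).aestronglyMeasurable measurableSet_Ioi)

theorem zeroExt_norm (f : ℝ → ℂ) (t : ℝ) :
    zeroExt (fun t => ((‖f t‖ : ℝ) : ℂ)) t = ((‖zeroExt f t‖ : ℝ) : ℂ) := by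
  rcases le_or_gt t 0 with ht | ht
  · simp [zeroExt_of_nonpos _ ht]
  · simp [zeroExt_of_pos _ ht]

/-- Associativity of convolution needs absolute integrability. This identity reduces that condition
to the existence of convolutions of functions in `C_{-1}`, which contains the norms of its elements.
-/
theorem convolution_norm_zeroExt (f g : ℝ → ℂ) :
    ((fun t => ‖zeroExt f t‖) ⋆[mul ℝ ℝ, volume] fun t => ‖zeroExt g t‖) =
      fun t => ‖zeroExt (conv (fun t => ((‖f t‖ : ℝ) : ℂ)) fun t => ((‖g t‖ : ℝ) : ℂ)) t‖ := by
  funext x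
  have h : ((((fun t => ‖zeroExt f t‖) ⋆[mul ℝ ℝ, volume] fun t => ‖zeroExt g t‖) x : ℝ) : ℂ) =
      zeroExt (conv (fun t => ((‖f t‖ : ℝ) : ℂ)) fun t => ((‖g t‖ : ℝ) : ℂ)) x := by
    rw [← convolution_zeroExt, MeasureTheory.convolution, MeasureTheory.convolution,
      ← integral_complex_ofReal]
    simp only [mul_apply', zeroExt_norm, Complex.ofReal_mul]
  rw [← h, Complex.norm_real, Real.norm_of_nonneg]
  exact integral_nonneg fun t => by simp only [mul_apply']; positivity

theorem conv_assoc {f g h : ℝ → ℂ} (hf : f ∈ CNegOne) (hg : g ∈ CNegOne) (hh : h ∈ CNegOne)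
    {t : ℝ} (ht : 0 < t) : conv (conv f g) h t = conv f (conv g h) t := by
  have key := convolution_assoc (mul ℝ ℂ) (mul ℝ ℂ) (mul ℝ ℂ) (mul ℝ ℂ)
    (fun x y z => by simp only [mul_apply', mul_assoc]) (x₀ := t)
    (CNegOne.aestronglyMeasurable_zeroExt hf) (CNegOne.aestronglyMeasurable_zeroExt hg)
    (CNegOne.aestronglyMeasurable_zeroExt hh)
    (Eventually.of_forall fun y => CNegOne.convolutionExistsAt hf hg y)
    (Eventually.of_forall fun y => CNegOne.convolutionExistsAt_norm hg hh y)
    (by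
      rw [convolution_norm_zeroExt]
      exact CNegOne.convolutionExistsAt_norm hf (CNegOne.conv (CNegOne.norm hg) (CNegOne.norm hh)) t)
  simpa only [convolution_zeroExt, zeroExt_of_pos _ ht] using key

/-- Makes functions vanishing on `(-∞, 0]` closed under `conv`. With this normalization, identities
known only for `t > 0` become equalities in the ring. -/
theorem conv_of_nonpos (f : ℝ → ℂ) {g : ℝ → ℂ} (hg : ∀ t, t ≤ 0 → g t = 0) {t : ℝ} (ht : t ≤ 0) :
    conv f g t = 0 := by
  rw [conv, intervalIntegral.integral_symm, neg_eq_zero,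
    intervalIntegral.integral_congr_Ioo_of_le (g := fun _ => (0 : ℂ)) ht fun x hx => by
      simp [hg x hx.2.le], intervalIntegral.integral_zero]

/-- `C_{-1}(0, ∞)` as a space of functions vanishing on `(-∞, 0]`. -/
def convSubmodule : Submodule ℂ (ℝ → ℂ) where
  carrier := {f | f ∈ CNegOne ∧ ∀ t, t ≤ 0 → f t = 0}
  add_mem' := fun ⟨hf, hf'⟩ ⟨hg, hg'⟩ =>
    ⟨CNegOne.add hf hg, fun t ht => by simp [hf' t ht, hg' t ht]⟩
  zero_mem' := ⟨zero_mem_CNegOne, fun _ _ => rfl⟩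
  smul_mem' := fun a _ ⟨hf, hf'⟩ => ⟨CNegOne.const_mul hf a, fun t ht => by simp [hf' t ht]⟩

/-- The convolution algebra `C_{-1}(0, ∞)`. -/
abbrev ConvAlg : Type := convSubmodule

namespace ConvAlg

theorem mem (f : ConvAlg) : (f : ℝ → ℂ) ∈ CNegOne := f.2.1

theorem ext_pos {f g : ConvAlg} (h : ∀ t, 0 < t → (f : ℝ → ℂ) t = (g : ℝ → ℂ) t) : f = g := by
  refine Subtype.ext (funext fun t => ?_)
  rcases le_or_gt t 0 with ht | ht
  · rw [f.2.2 t ht, g.2.2 t ht]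
  · exact h t ht

instance : Mul ConvAlg :=
  ⟨fun f g => ⟨conv f g, CNegOne.conv f.mem g.mem, fun _ ht => conv_of_nonpos _ g.2.2 ht⟩⟩

theorem coe_mul (f g : ConvAlg) : ((f * g : ConvAlg) : ℝ → ℂ) = conv f g := rfl

theorem mul_comm' (f g : ConvAlg) : f * g = g * f :=
  ext_pos fun t _ => conv_comm f g t

theorem mul_add' (f g h : ConvAlg) : f * (g + h) = f * g + f * h :=
  ext_pos fun _ ht => conv_add f.mem g.mem h.mem ht

theorem mul_smul' (a : ℂ) (f g : ConvAlg) : f * (a • g) = a • (f * g) :=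
  ext_pos fun t _ => conv_const_mul f g a t

instance : NonUnitalCommRing ConvAlg where
  left_distrib := mul_add'
  right_distrib f g h := by rw [mul_comm', mul_add', mul_comm' h f, mul_comm' h g]
  zero_mul f := by rw [mul_comm']; simpa using mul_smul' 0 f 0
  mul_zero f := by simpa using mul_smul' 0 f 0
  mul_assoc f g h := ext_pos fun _ ht => conv_assoc f.mem g.mem h.mem ht
  mul_comm := mul_comm'

instance : SMulCommClass ℂ ConvAlg ConvAlg := ⟨fun a f g => (mul_smul' a f g).symm⟩

instance : IsScalarTower ℂ ConvAlg ConvAlg :=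
  ⟨fun a f g => by rw [smul_eq_mul, smul_eq_mul, mul_comm', mul_smul', mul_comm']⟩

/-- The element of the convolution algebra defined by a function of `C_{-1}(0, ∞)`. -/
def ofMem {f : ℝ → ℂ} (hf : f ∈ CNegOne) : ConvAlg :=
  ⟨zeroExt f, CNegOne.zeroExt hf, fun _ ht => zeroExt_of_nonpos f ht⟩

theorem ofMem_apply {f : ℝ → ℂ} (hf : f ∈ CNegOne) {t : ℝ} (ht : 0 < t) :
    (ofMem hf : ℝ → ℂ) t = f t := zeroExt_of_pos f ht

end ConvAlg

/-- The convolution algebra with a unit adjoined. -/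
abbrev UnitConvAlg : Type := Unitization ℂ ConvAlg

end ConvolutionAlgebra

/-! ### Convergence of `l_{κ,z}` and its resolvent identity. -/

section ConvolutionSeries

open MeasureTheory Filter Topology

/-- Cut the Gamma integral to `(B, ∞)`, where `x ^ s ≥ B ^ s`. As `B` is free, `Γ` outgrows every
geometric sequence. -/
theorem rpow_mul_exp_neg_le_Gamma {s B : ℝ} (hs : 0 < s) (hB : 0 < B) :
    B ^ s * Real.exp (-B) ≤ Real.Gamma (s + 1) := by
  rw [Real.Gamma_eq_integral (by linarith), add_sub_cancel_right, ← integral_exp_neg_Ioi,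
    ← integral_const_mul]
  have hi := Real.GammaIntegral_convergent (s := s + 1) (by linarith)
  rw [add_sub_cancel_right] at hi
  have hsub : Ioi B ⊆ Ioi 0 := Ioi_subset_Ioi hB.le
  calc ∫ x in Ioi B, B ^ s * Real.exp (-x) ≤ ∫ x in Ioi B, Real.exp (-x) * x ^ s := by
        refine setIntegral_mono_on ((integrableOn_exp_neg_Ioi B).const_mul _)
          (hi.mono_set hsub) measurableSet_Ioi fun x hx => ?_
        rw [mul_comm]
        gcongr
        exact le_of_lt hx
    _ ≤ _ := by
        refine setIntegral_mono_set hi ?_ hsub.eventuallyLE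
        filter_upwards [ae_restrict_mem measurableSet_Ioi] with x hx
        have : (0:ℝ) < x := hx
        exact mul_nonneg (Real.exp_pos _).le (Real.rpow_nonneg this.le s)

theorem exists_pow_div_Gamma_le {α x : ℝ} (hα : 0 < α) (hα1 : α ≤ 1) (hx : 0 ≤ x) :
    ∃ C : ℝ, 0 ≤ C ∧ ∀ j : ℕ, x ^ j / Real.Gamma ((j + 1) * α) ≤ C * (1 / 2) ^ j := by
  -- With `B ^ α = y` the Gamma bound produces `y ^ (j + 1) ≥ (4 x) ^ j`. One factor `2 ^ j` of `4 ^
  -- j` absorbs `(j + 1) α ≤ 2 ^ j`, from `Γ(s + 1) = s Γ(s)`; the other gives `(1 / 2) ^ j`. The `+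
  -- 1` keeps `y` positive and at least `1`.
  set y := 4 * x + 1 with hy
  have hy0 : 0 < y := by positivity
  set B := y ^ (1 / α) with hB
  have hB0 : 0 < B := Real.rpow_pos_of_pos hy0 _
  have hBα : B ^ α = y := by
    rw [hB, ← Real.rpow_mul hy0.le, one_div_mul_cancel hα.ne', Real.rpow_one]
  refine ⟨Real.exp B, (Real.exp_pos _).le, fun j => ?_⟩
  have hs : 0 < ((j : ℝ) + 1) * α := by positivity
  have h1 := rpow_mul_exp_neg_le_Gamma hs hB0
  rw [Real.Gamma_add_one hs.ne', mul_comm ((j : ℝ) + 1) α, Real.rpow_mul hB0.le, hBα,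
    mul_comm α] at h1
  have hG : 0 < Real.Gamma (((j : ℝ) + 1) * α) := Real.Gamma_pos_of_pos hs
  have hjj : ((j : ℝ) + 1) * α ≤ 2 ^ j := by
    have : ((j + 1 : ℕ) : ℝ) ≤ ((2 ^ j : ℕ) : ℝ) := by exact_mod_cast Nat.lt_two_pow_self
    push_cast at this
    nlinarith [this]
  have hyp : y ^ ((j : ℝ) + 1) = y ^ j * y := by
    rw [Real.rpow_add hy0, Real.rpow_natCast, Real.rpow_one]
  rw [hyp, Real.exp_neg] at h1
  have h2 : y ^ j * y ≤ 2 ^ j * Real.Gamma ((j + 1) * α) * Real.exp B := by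
    have := Real.exp_pos B
    rw [← div_eq_mul_inv, div_le_iff₀ this] at h1
    exact h1.trans (by gcongr)
  have h3 : (4 * x) ^ j ≤ y ^ j * y := by
    have e : (4 * x) ^ j ≤ y ^ j := pow_le_pow_left₀ (by positivity) (by linarith) j
    have : y ^ j * 1 ≤ y ^ j * y := by gcongr; linarith
    linarith
  rw [div_le_iff₀ hG]
  have h4 : (4 : ℝ) ^ j = 2 ^ j * 2 ^ j := by rw [← mul_pow]; norm_num
  have h5 : (2 : ℝ) ^ j * (1 / 2) ^ j = 1 := by rw [← mul_pow]; norm_num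
  have h6 : (0 : ℝ) < 2 ^ j := by positivity
  have h7 : 2 ^ j * (2 ^ j * x ^ j) ≤ 2 ^ j * (Real.Gamma ((j + 1) * α) * Real.exp B) := by
    calc _ = (4 * x) ^ j := by rw [mul_pow, h4]; ring
      _ ≤ _ := h3.trans (h2.trans (by linarith))
  have h8 := le_of_mul_le_mul_left h7 h6
  refine le_of_mul_le_mul_left (h8.trans (le_of_eq ?_)) h6
  calc _ = (2 ^ j * (1 / 2) ^ j) * (Real.Gamma ((j + 1) * α) * Real.exp B) := by rw [h5, one_mul]
    _ = _ := by ring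

theorem convPow_succ_succ (g : ℝ → ℂ) (j : ℕ) :
    convPow g (j + 1 + 1) = conv (convPow g (j + 1)) g := rfl

theorem HasOrder.convPow {p : ℝ} {g : ℝ → ℂ} (hg : HasOrder p g) (hp : -1 < p) (j : ℕ) :
    HasOrder p (convPow g (j + 1)) := by
  induction j with
  | zero => exact hg
  | succ j ih =>
    rw [convPow_succ_succ]
    exact (ih.conv hg hp hp).mono (by linarith)

theorem CNegOne.convPow {g : ℝ → ℂ} (hg : g ∈ CNegOne) (j : ℕ) : convPow g (j + 1) ∈ CNegOne := by
  obtain ⟨p, hp, hg⟩ := mem_CNegOne_iff.1 hg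
  exact (hg.convPow hp j).mem hp

/-- Induction on `j`: each convolution with `t ^ (α - 1)` contributes a Beta function, and the Gamma
quotients telescope. -/
theorem norm_convPow_le {α M T : ℝ} {g : ℝ → ℂ} (hα : 0 < α) (hM : 0 ≤ M)
    (hg : ∀ t, 0 < t → t ≤ T → ‖g t‖ ≤ M * t ^ (α - 1)) (j : ℕ) (t : ℝ) (ht : 0 < t)
    (htT : t ≤ T) :
    ‖convPow g (j + 1) t‖ ≤ (M * Real.Gamma α) ^ (j + 1) / Real.Gamma ((j + 1) * α) *
      t ^ ((j + 1) * α - 1) := by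
  have hΓ := Real.Gamma_pos_of_pos hα
  induction j generalizing t with
  | zero =>
    simpa [convPow, hΓ.ne'] using hg t ht htT
  | succ j ih =>
    have hs : 0 < ((j : ℝ) + 1) * α := by positivity
    have hG : 0 < Real.Gamma (((j : ℝ) + 1) * α) := Real.Gamma_pos_of_pos hs
    rw [convPow_succ_succ]
    refine (norm_conv_le (p := (j + 1) * α - 1) (q := α - 1) (by linarith) (by linarith) ht ?_
      (fun s hs hst => ih s hs (hst.trans htT))
      (fun s hs hst => hg s hs (hst.trans htT))).trans (le_of_eq ?_)
    · positivity
    · rw [show ((j : ℝ) + 1) * α - 1 + (α - 1) + 1 = ((j + 1 : ℕ) + 1) * α - 1 by push_cast; ring,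
        show ((j : ℝ) + 1) * α - 1 + (α - 1) + 2 = ((j + 1 : ℕ) + 1) * α by push_cast; ring,
        sub_add_cancel, sub_add_cancel]
      field_simp
      ring

theorem exists_geometric_bound {p : ℝ} {g : ℝ → ℂ} (hg : HasOrder p g) (hp : -1 < p) (hp0 : p < 0)
    (z : ℂ) {T : ℝ} (hT : 0 < T) :
    ∃ C : ℝ, 0 ≤ C ∧ ∀ (j : ℕ) (t : ℝ), 0 < t → t ≤ T →
      ‖z ^ j * convPow g (j + 1) t‖ ≤ C * (1 / 2) ^ j * t ^ p := by
  obtain ⟨M, hM, hb⟩ := hg.exists_bound T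
  have hα : 0 < p + 1 := by linarith
  have hΓ := Real.Gamma_pos_of_pos hα
  obtain ⟨C, hC, hb'⟩ := exists_pow_div_Gamma_le (x := ‖z‖ * (M * Real.Gamma (p + 1)) * T ^ (p + 1))
    hα (by linarith) (by positivity)
  refine ⟨M * Real.Gamma (p + 1) * C, by positivity, fun j t ht htT => ?_⟩
  have h1 := norm_convPow_le (α := p + 1) hα hM.le (by simpa using hb) j t ht htT
  have h2 : t ^ ((j + 1) * (p + 1) - 1) ≤ (T ^ (p + 1)) ^ j * t ^ p := by
    rw [show ((j : ℝ) + 1) * (p + 1) - 1 = (p + 1) * j + p by ring, Real.rpow_add ht,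
      Real.rpow_mul ht.le, Real.rpow_natCast]
    gcongr
  have hG : 0 < Real.Gamma (((j : ℝ) + 1) * (p + 1)) := Real.Gamma_pos_of_pos (by positivity)
  rw [norm_mul, norm_pow]
  calc ‖z‖ ^ j * ‖convPow g (j + 1) t‖
      ≤ ‖z‖ ^ j * ((M * Real.Gamma (p + 1)) ^ (j + 1) / Real.Gamma ((j + 1) * (p + 1)) *
          ((T ^ (p + 1)) ^ j * t ^ p)) := by
        gcongr
        exact h1.trans (by gcongr)
    _ = M * Real.Gamma (p + 1) * ((‖z‖ * (M * Real.Gamma (p + 1)) * T ^ (p + 1)) ^ j /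
          Real.Gamma ((j + 1) * (p + 1))) * t ^ p := by
        rw [mul_pow, mul_pow]; ring
    _ ≤ M * Real.Gamma (p + 1) * (C * (1 / 2) ^ j) * t ^ p := by
        gcongr
        exact hb' j
    _ = _ := by ring

/-- The exponent may be lowered below `0`, so that `α = p + 1` lies in `(0, 1)` as the Gamma
estimate requires. -/
theorem exists_hasOrder_neg {f : ℝ → ℂ} (hf : f ∈ CNegOne) :
    ∃ p : ℝ, -1 < p ∧ p < 0 ∧ HasOrder p f := by
  obtain ⟨p, hp, h⟩ := mem_CNegOne_iff.1 hf
  exact ⟨min p (-1 / 2), lt_min hp (by norm_num), (min_le_right _ _).trans_lt (by norm_num),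
    h.mono (min_le_left _ _)⟩

theorem summable_geometric_bound (C : ℝ) : Summable fun j : ℕ => C * (1 / 2 : ℝ) ^ j :=
  (summable_geometric_of_lt_one (by norm_num) (by norm_num)).mul_left C

theorem summable_convSeries {g : ℝ → ℂ} (hg : g ∈ CNegOne) (z : ℂ) {t : ℝ} (ht : 0 < t) :
    Summable fun j : ℕ => z ^ j * convPow g (j + 1) t := by
  obtain ⟨p, hp, hp0, h⟩ := exists_hasOrder_neg hg
  obtain ⟨C, -, hb⟩ := exists_geometric_bound h hp hp0 z ht
  exact Summable.of_norm_bounded ((summable_geometric_bound C).mul_right _)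
    fun j => hb j t ht le_rfl

theorem HasOrder.convSeries {p : ℝ} {g : ℝ → ℂ} (hg : HasOrder p g) (hp : -1 < p) (hp0 : p < 0)
    (z : ℂ) : HasOrder p (convSeries g z) := by
  -- All convolution powers share the exponent `p`, so `t ^ p` factors out of the series; the series
  -- of regular factors converges uniformly on compact subsets of `[0, ∞)`.
  choose F hF hFe using fun j => hg.convPow hp j
  refine hasOrder_of_continuousOn (f₁ := fun t => ∑' j, z ^ j * F j t) ?_ fun t ht => ?_
  · intro t ht
    have ht0 : (0:ℝ) ≤ t := ht
    obtain ⟨C, hC, hb⟩ := exists_geometric_bound hg hp hp0 z (T := t + 1) (by linarith)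
    have hb' : ∀ (j : ℕ) (s : ℝ), s ∈ Icc 0 (t + 1) → ‖z ^ j * F j s‖ ≤ C * (1 / 2) ^ j := by
      intro j
      have hcl : IsClosed {s | ‖z ^ j * F j s‖ ≤ C * (1 / 2) ^ j} :=
        isClosed_le (by have := hF j; fun_prop) continuous_const
      have hsub : Ioc 0 (t + 1) ⊆ {s | ‖z ^ j * F j s‖ ≤ C * (1 / 2) ^ j} := by
        intro s hs
        have h1 := hb j s hs.1 hs.2
        have hsp := Real.rpow_pos_of_pos hs.1 p
        rw [hFe j s hs.1, mul_left_comm, norm_mul, Complex.norm_real, Real.norm_of_nonneg hsp.le,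
          mul_comm] at h1
        exact le_of_mul_le_mul_right h1 hsp
      -- The bound is known for `s > 0` only; continuity of `F j` carries it to `s = 0`.
      have := closure_minimal hsub hcl
      rwa [closure_Ioc (by linarith : (0:ℝ) ≠ t + 1)] at this
    have hc : ContinuousOn (fun t => ∑' j, z ^ j * F j t) (Icc 0 (t + 1)) :=
      continuousOn_tsum (fun j => by have := hF j; fun_prop) (summable_geometric_bound C) hb'
    refine (hc t ⟨ht0, by linarith⟩).mono_of_mem_nhdsWithin ?_
    rw [← Ici_inter_Iic]
    exact inter_mem self_mem_nhdsWithin (mem_nhdsWithin_of_mem_nhds (Iic_mem_nhds (by linarith)))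
  · rw [GFD.convSeries, ← tsum_mul_left]
    congr 1
    funext j
    rw [hFe j t ht, mul_left_comm]

theorem CNegOne.convSeries {g : ℝ → ℂ} (hg : g ∈ CNegOne) (z : ℂ) : convSeries g z ∈ CNegOne := by
  obtain ⟨p, hp, hp0, h⟩ := exists_hasOrder_neg hg
  exact (h.convSeries hp hp0 z).mem hp

theorem hasSum_conv_convSeries {g : ℝ → ℂ} (hg : g ∈ CNegOne) (z : ℂ) {t : ℝ} (ht : 0 < t) :
    HasSum (fun j : ℕ => z ^ j * convPow g (j + 1 + 1) t) (conv (convSeries g z) g t) := by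
  obtain ⟨p, hp, hp0, h⟩ := exists_hasOrder_neg hg
  obtain ⟨C, hC, hb⟩ := exists_geometric_bound h hp hp0 z ht
  obtain ⟨M, hM, hgb⟩ := h.exists_bound t
  have hne : ∀ᵐ x : ℝ, x ≠ t := by simp [ae_iff]
  have key := intervalIntegral.hasSum_integral_of_dominated_convergence (μ := volume)
    (a := 0) (b := t)
    (F := fun (j : ℕ) τ => z ^ j * (convPow g (j + 1) (t - τ) * g τ))
    (f := fun τ => convSeries g z (t - τ) * g τ)
    (fun j τ => C * (1 / 2) ^ j * (M * ((t - τ) ^ p * τ ^ p))) ?_ ?_ ?_ ?_ ?_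
  · simp only [intervalIntegral.integral_const_mul] at key
    exact key
  · intro j
    rw [uIoc_of_le ht.le]
    exact (((h.convPow hp j).intervalIntegrable_conv h hp hp ht).const_mul _).1.aestronglyMeasurable
  · intro j
    filter_upwards [hne] with x hxt hx
    rw [uIoc_of_le ht.le] at hx
    have hx1 : 0 < t - x := sub_pos.2 (lt_of_le_of_ne hx.2 hxt)
    rw [← mul_assoc, norm_mul]
    calc _ ≤ (C * (1 / 2) ^ j * (t - x) ^ p) * (M * x ^ p) := by
          gcongr
          · exact hb j _ hx1 (by linarith [hx.1])
          · exact hgb _ hx.1 hx.2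
      _ = _ := by ring
  · exact Eventually.of_forall fun x _ => (summable_geometric_bound C).mul_right _
  · simp only [tsum_mul_right]
    exact ((intervalIntegrable_beta hp hp ht).const_mul _).const_mul _
  · filter_upwards [hne] with x hxt hx
    rw [uIoc_of_le ht.le] at hx
    have hx1 : 0 < t - x := sub_pos.2 (lt_of_le_of_ne hx.2 hxt)
    simp only [← mul_assoc]
    exact (summable_convSeries hg z hx1).hasSum.mul_right _

theorem convSeries_eq {g : ℝ → ℂ} (hg : g ∈ CNegOne) (z : ℂ) {t : ℝ} (ht : 0 < t) :
    convSeries g z t = g t + z * conv (convSeries g z) g t := by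
  rw [convSeries, (summable_convSeries hg z ht).tsum_eq_zero_add,
    ← (hasSum_conv_convSeries hg z ht).tsum_eq, ← tsum_mul_left]
  simp only [pow_zero, one_mul, pow_succ', mul_assoc]
  rfl

open ConvAlg

/-- Splitting off the first term of the series gives `l = κ + z (l * κ)`. This is the only property
of `l` that the algebra uses. -/
theorem ofMem_convSeries_mul {g : ℝ → ℂ} (hg : g ∈ CNegOne) (z : ℂ) :
    (Unitization.inr (ofMem (CNegOne.convSeries hg z)) : UnitConvAlg) *
      (1 - z • Unitization.inr (ofMem hg)) = Unitization.inr (ofMem hg) := by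
  have h : ofMem (CNegOne.convSeries hg z) =
      ofMem hg + z • (ofMem (CNegOne.convSeries hg z) * ofMem hg) := by
    refine ext_pos fun t ht => ?_
    rw [ofMem_apply _ ht, convSeries_eq hg z ht]
    change _ = zeroExt g t + z * conv (zeroExt _) (zeroExt g) t
    rw [zeroExt_of_pos _ ht, conv_congr (fun s hs => zeroExt_of_pos _ hs)
      (fun s hs => zeroExt_of_pos _ hs) ht]
  have h2 := congrArg (Unitization.inr : ConvAlg → UnitConvAlg) h
  rw [Unitization.inr_add, Unitization.inr_smul, Unitization.inr_mul] at h2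
  rw [mul_sub, mul_one, mul_smul_comm]
  nth_rewrite 1 [h2]
  rw [add_sub_cancel_right]

theorem inr_ofMem_convPow {g : ℝ → ℂ} (hg : g ∈ CNegOne) (j : ℕ) :
    (Unitization.inr (ofMem (CNegOne.convPow hg j)) : UnitConvAlg) =
      Unitization.inr (ofMem hg) ^ (j + 1) := by
  induction j with
  | zero => exact (pow_one _).symm
  | succ j ih =>
    rw [pow_succ, ← ih, ← Unitization.inr_mul]
    congr 1
    refine ext_pos fun t ht => ?_
    rw [ofMem_apply _ ht, coe_mul, convPow_succ_succ]
    exact (conv_congr (fun s hs => ofMem_apply _ hs) (fun s hs => ofMem_apply _ hs) ht).symm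

end ConvolutionSeries

/-! ### The fractional derivative and the reduction to chains. -/

section Derivative

open MeasureTheory Filter Topology

/-- The power kernel `t ^ j / j!`. -/
def powerKernel (j : ℕ) (t : ℝ) : ℂ := (t : ℂ) ^ j / (j.factorial : ℂ)

theorem powerKernel_mem (j : ℕ) : powerKernel j ∈ CNegOne :=
  ⟨0, by norm_num, powerKernel j, by unfold powerKernel; fun_prop, fun t _ => by simp⟩

theorem hasDerivAt_conv_one {g : ℝ → ℂ} (hg : g ∈ CNegOne) {t : ℝ} (ht : 0 < t) :
    HasDerivAt (conv (powerKernel 0) g) (g t) t := by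
  have hc := CNegOne.continuousOn hg
  have e : conv (powerKernel 0) g = fun t => ∫ τ in (0:ℝ)..t, g τ := by
    funext t
    simp [conv, powerKernel]
  have hi := CNegOne.intervalIntegrable_conv (powerKernel_mem 0) hg ht
  simp only [powerKernel, pow_zero, Nat.factorial_zero, Nat.cast_one, div_one, one_mul] at hi
  rw [e]
  exact intervalIntegral.integral_hasDerivAt_right hi
    (hc.stronglyMeasurableAtFilter isOpen_Ioi t ht) (hc.continuousAt (Ioi_mem_nhds ht))

theorem conv_powerKernel_zero (j : ℕ) (t : ℝ) :
    conv (powerKernel 0) (powerKernel j) t = powerKernel (j + 1) t := by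
  simp only [conv, powerKernel, pow_zero, Nat.factorial_zero, Nat.cast_one, div_one, one_mul]
  rw [intervalIntegral.integral_div]
  have h : ∫ τ in (0:ℝ)..t, (τ : ℂ) ^ j = (t : ℂ) ^ (j + 1) / (j + 1) := by
    have h1 := integral_pow (a := 0) (b := t) j
    have h2 := congrArg (fun x : ℝ => (x : ℂ)) h1
    simp only [← intervalIntegral.integral_ofReal] at h2
    push_cast at h2
    simpa using h2
  rw [h, div_div, Nat.factorial_succ]
  push_cast
  rfl

theorem contDiffOn_of_hasDerivAt {F G : ℝ → ℂ} {j : ℕ} (hG : ContDiffOn ℝ j G (Ioi 0))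
    (h : ∀ t, 0 < t → HasDerivAt F (G t) t) :
    ContDiffOn ℝ (j + 1 : ℕ) F (Ioi 0) ∧
      ∀ t, 0 < t → iteratedDeriv (j + 1) F t = iteratedDeriv j G t := by
  have he : EqOn (deriv F) G (Ioi 0) := fun t ht => (h t ht).deriv
  constructor
  · have := (contDiffOn_succ_iff_deriv_of_isOpen (𝕜 := ℝ) (f := F) (n := (j : WithTop ℕ∞))
      isOpen_Ioi).2 ⟨fun t ht => (h t ht).differentiableAt.differentiableWithinAt, by simp,
        hG.congr he⟩
    exact_mod_cast this
  · intro t ht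
    rw [iteratedDeriv_succ']
    exact he.iteratedDeriv_of_isOpen isOpen_Ioi j ht

/-- Convolution with `t ^ j / j!` is `(j + 1)`-fold integration, by peeling off one convolution with
`1` at a time. -/
theorem conv_powerKernel {g : ℝ → ℂ} (hg : g ∈ CNegOne) (j : ℕ) :
    ContDiffOn ℝ (j + 1 : ℕ) (conv (powerKernel j) g) (Ioi 0) ∧
      ∀ t, 0 < t → iteratedDeriv (j + 1) (conv (powerKernel j) g) t = g t := by
  induction j with
  | zero =>
    exact contDiffOn_of_hasDerivAt (j := 0)
      (contDiffOn_zero.2 (CNegOne.continuousOn hg)) fun t ht => hasDerivAt_conv_one hg ht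
  | succ j ih =>
    have hm := CNegOne.conv (powerKernel_mem j) hg
    have he : ∀ t, 0 < t → conv (powerKernel (j + 1)) g t =
        conv (powerKernel 0) (conv (powerKernel j) g) t := by
      intro t ht
      rw [← conv_assoc (powerKernel_mem 0) (powerKernel_mem j) hg ht]
      exact conv_congr (fun s _ => (conv_powerKernel_zero j s).symm) (fun _ _ => rfl) ht
    have h := contDiffOn_of_hasDerivAt ih.1 fun t ht =>
      (hasDerivAt_conv_one hm ht).congr_of_eventuallyEq (by
        filter_upwards [Ioi_mem_nhds ht] with s hs using he s hs)
    exact ⟨h.1, fun t ht => (h.2 t ht).trans (ih.2 t ht)⟩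

/-- `𝔻_{(k)} y` exists on `(0, ∞)` and equals `d` there. -/
def HasGfd (n : ℕ) (k y d : ℝ → ℂ) : Prop :=
  ContDiffOn ℝ n (conv k y) (Ioi 0) ∧ ∀ t, 0 < t → gfd n k y t = d t

theorem gfd_congr {n : ℕ} {k y y' : ℝ → ℂ} (h : ∀ t, 0 < t → y' t = y t) {t : ℝ} (ht : 0 < t) :
    gfd n k y' t = gfd n k y t := by
  have he : EqOn (conv k y') (conv k y) (Ioi 0) := fun s hs => conv_congr (fun _ _ => rfl) h hs
  exact he.iteratedDeriv_of_isOpen isOpen_Ioi n ht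

theorem HasGfd.congr {n : ℕ} {k y d y' d' : ℝ → ℂ} (h : HasGfd n k y d)
    (hy : ∀ t, 0 < t → y' t = y t) (hd : ∀ t, 0 < t → d' t = d t) : HasGfd n k y' d' :=
  ⟨h.1.congr fun _ hs => conv_congr (fun _ _ => rfl) hy hs,
    fun t ht => by rw [gfd_congr hy ht, h.2 t ht, hd t ht]⟩

theorem CNegOneZero.mem_CNegOne {k : ℝ → ℂ} (hk : k ∈ CNegOneZero) : k ∈ CNegOne := by
  obtain ⟨p, hp, -, h⟩ := hk
  exact ⟨p, hp, h⟩

theorem HasGfd.add {n : ℕ} {k y d y' d' : ℝ → ℂ} (hk : k ∈ CNegOne) (hy : y ∈ CNegOne)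
    (hy' : y' ∈ CNegOne) (h : HasGfd n k y d) (h' : HasGfd n k y' d') :
    HasGfd n k (fun t => y t + y' t) (fun t => d t + d' t) := by
  have he : EqOn (conv k fun t => y t + y' t) (conv k y + conv k y') (Ioi 0) :=
    fun t ht => conv_add hk hy hy' ht
  refine ⟨(h.1.add h'.1).congr he, fun t ht => ?_⟩
  rw [gfd, he.iteratedDeriv_of_isOpen isOpen_Ioi n ht,
    iteratedDeriv_add (h.1.contDiffAt (Ioi_mem_nhds ht)) (h'.1.contDiffAt (Ioi_mem_nhds ht))]
  exact congrArg₂ _ (h.2 t ht) (h'.2 t ht)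

/-- By associativity `k * (κ * f)` is the `n`-fold integral of `f`, and `n` derivatives recover `f`.
-/
theorem KernelPair.hasGfd_conv {n : ℕ} {κ k f : ℝ → ℂ} (hn : 1 ≤ n) (h : KernelPair n κ k)
    (hf : f ∈ CNegOne) : HasGfd n k (conv κ f) f := by
  obtain ⟨j, rfl⟩ : ∃ j, n = j + 1 := ⟨n - 1, by omega⟩
  have hk := CNegOneZero.mem_CNegOne h.right_mem
  have he : EqOn (conv k (conv κ f)) (conv (powerKernel j) f) (Ioi 0) := by
    intro t ht
    rw [← conv_assoc hk h.left_mem hf ht]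
    refine conv_congr (fun s hs => ?_) (fun _ _ => rfl) ht
    rw [conv_comm, h.conv_eq s hs, powerKernel, Nat.add_sub_cancel]
  obtain ⟨h1, h2⟩ := conv_powerKernel hf j
  exact ⟨h1.congr he, fun t ht => (he.iteratedDeriv_of_isOpen isOpen_Ioi _ ht).trans (h2 t ht)⟩

theorem seqGfd_succ (n : ℕ) (k : ℝ → ℂ) (p : ℕ) (f : ℝ → ℂ) :
    seqGfd n k (p + 1) f = gfd n k (seqGfd n k p f) :=
  Function.iterate_succ_apply' _ _ _

open ConvAlg

/-- Solutions of the Cauchy problem correspond to chains of successive derivatives in the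
convolution algebra. -/
theorem isSolution_iff {n m : ℕ} {κ k : ℝ → ℂ} (hn : 1 ≤ n) (hκk : KernelPair n κ k) {c : ℕ → ℂ}
    {f : ℝ → ℂ} {γ : ℕ → ℝ → ℂ} {Φ : ConvAlg} (hΦ : ∀ t, 0 < t → (Φ : ℝ → ℂ) t = f t)
    {Γ : ℕ → ConvAlg} (hΓ : ∀ p < m, ∀ t, 0 < t → (Γ p : ℝ → ℂ) t = γ p t)
    (hΓk : ∀ p < m, HasGfd n k (Γ p) 0) {y : ℝ → ℂ} :
    IsSolution n m κ k c f γ y ↔ ∃ Y : ℕ → ConvAlg, (∀ t, 0 < t → y t = (Y 0 : ℝ → ℂ) t) ∧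
      (∀ p < m, Y p = ofMem hκk.left_mem * Y (p + 1) + Γ p) ∧
      ∑ p ∈ Finset.range (m + 1), c p • Y p = Φ := by
  have hk := CNegOneZero.mem_CNegOne hκk.right_mem
  have hmul : ∀ (g : ℝ → ℂ) (G : ConvAlg), (∀ t, 0 < t → (G : ℝ → ℂ) t = g t) → ∀ t, 0 < t →
      ((ofMem hκk.left_mem * G : ConvAlg) : ℝ → ℂ) t = conv κ g t := fun g G h t ht =>
    conv_congr (fun s hs => ofMem_apply _ hs) h ht
  have hsum : ∀ (Y : ℕ → ConvAlg) (s : Finset ℕ) (t : ℝ),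
      ((∑ p ∈ s, c p • Y p : ConvAlg) : ℝ → ℂ) t = ∑ p ∈ s, c p * (Y p : ℝ → ℂ) t := by
    intro Y s t
    rw [AddSubmonoidClass.coe_finsetSum, Finset.sum_apply]
    rfl
  constructor
  · intro h
    have hmem : ∀ p ≤ m, seqGfd n k p y ∈ CNegOne := by
      intro p hp
      rcases p with _ | p
      · exact h.mem.1
      · exact (h.mem.2 p hp).2
    refine ⟨fun p => if hp : p ≤ m then ofMem (hmem p hp) else 0, ?_, ?_, ?_⟩
    · intro t ht
      beta_reduce
      rw [dif_pos (Nat.zero_le m), ofMem_apply _ ht]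
      rfl
    · intro p hp
      beta_reduce
      rw [dif_pos hp.le, dif_pos (show p + 1 ≤ m from hp)]
      refine ext_pos fun t ht => ?_
      change _ = ((ofMem hκk.left_mem * ofMem _ : ConvAlg) : ℝ → ℂ) t + (Γ p : ℝ → ℂ) t
      rw [hmul _ _ (fun s hs => ofMem_apply _ hs) t ht, hΓ p hp t ht, ← h.initial p hp t ht, proj,
        seqGfd_succ, ofMem_apply _ ht, add_sub_cancel]
    · refine ext_pos fun t ht => ?_
      rw [hΦ t ht, ← h.equation t ht, hsum]
      refine Finset.sum_congr rfl fun p hp => ?_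
      rw [dif_pos (Nat.lt_succ_iff.1 (Finset.mem_range.1 hp)), ofMem_apply _ ht]
  · rintro ⟨Y, hY0, hY, hYs⟩
    -- Apply `𝔻_{(k)}` to `κ * Y (p + 1) + Γ p`: it undoes `κ *` and kills `Γ p`.
    have hd : ∀ p < m, HasGfd n k (Y p) (Y (p + 1)) := by
      intro p hp
      have h1 := (hκk.hasGfd_conv hn (Y (p + 1)).mem).congr
        (hmul _ (Y (p + 1)) fun _ _ => rfl) (fun _ _ => rfl)
      refine (h1.add hk (ConvAlg.mem _) (Γ p).mem (hΓk p hp)).congr (fun t _ => ?_) (fun t _ => ?_)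
      · rw [hY p hp]; rfl
      · simp
    have hs : ∀ p ≤ m, ∀ t, 0 < t → seqGfd n k p y t = (Y p : ℝ → ℂ) t := by
      intro p
      induction p with
      | zero => exact fun _ => hY0
      | succ p ih =>
        intro hp t ht
        rw [seqGfd_succ, gfd_congr (ih (by omega)) ht]
        exact (hd p hp).2 t ht
    refine ⟨⟨CNegOne.congr (Y 0).mem hY0, fun i hi => ⟨?_, ?_⟩⟩, fun t ht => ?_, fun p hp t ht => ?_⟩
    · exact ((hd i hi).congr (hs i hi.le) fun _ _ => rfl).1
    · exact CNegOne.congr (Y (i + 1)).mem (hs (i + 1) hi)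
    · rw [← hΦ t ht, ← hYs, hsum]
      refine Finset.sum_congr rfl fun p hp => ?_
      rw [hs p (Nat.lt_succ_iff.1 (Finset.mem_range.1 hp)) t ht]
    · rw [proj, ← seqGfd_succ, hs p hp.le t ht, ← hΓ p hp t ht,
        ← hmul _ (Y (p + 1)) (fun s hs' => (hs (p + 1) hp s hs').symm) t ht, hY p hp]
      change ((ofMem hκk.left_mem * Y (p + 1) : ConvAlg) : ℝ → ℂ) t + (Γ p : ℝ → ℂ) t - _ = _
      rw [add_sub_cancel_left]

end Derivative

/-! ### Reversed polynomials and partial fractions. -/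

section PartialFractions

open Polynomial

/-- The reversed polynomial `∑_{p=0}^m c_p X ^ (m - p)`. -/
def revPoly (c : ℕ → ℂ) (m : ℕ) : ℂ[X] := ∑ p ∈ Finset.range (m + 1), C (c p) * X ^ (m - p)

/-- The reversed numerator `∑_{j=1}^{m-p} c_{p+j} X ^ (m - j)`. -/
def revInitPoly (c : ℕ → ℂ) (m p : ℕ) : ℂ[X] :=
  ∑ j ∈ Finset.Icc 1 (m - p), C (c (p + j)) * X ^ (m - j)

theorem eval_revPoly (c : ℕ → ℂ) (m : ℕ) {w : ℂ} (hw : w ≠ 0) :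
    (revPoly c m).eval w = w ^ m * charPoly c m w⁻¹ := by
  rw [revPoly, eval_finsetSum, charPoly, Finset.mul_sum]
  refine Finset.sum_congr rfl fun p hp => ?_
  have hp' : p ≤ m := Nat.lt_succ_iff.1 (Finset.mem_range.1 hp)
  simp only [eval_mul, eval_C, eval_pow, eval_X]
  rw [pow_sub₀ w hw hp', inv_pow]
  ring

theorem eval_revInitPoly (c : ℕ → ℂ) (m p : ℕ) {w : ℂ} (hw : w ≠ 0) :
    (revInitPoly c m p).eval w = w ^ m * initPoly c m p w⁻¹ := by
  rw [revInitPoly, eval_finsetSum, initPoly, Finset.mul_sum]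
  refine Finset.sum_congr rfl fun j hj => ?_
  have hj' : j ≤ m := (Finset.mem_Icc.1 hj).2.trans (Nat.sub_le _ _)
  simp only [eval_mul, eval_C, eval_pow, eval_X]
  rw [pow_sub₀ w hw hj', inv_pow]
  ring

theorem infinite_eval_ne_zero {q : ℂ[X]} (hq : q ≠ 0) : {w : ℂ | q.eval w ≠ 0}.Infinite := by
  have hf : {w : ℂ | q.eval w = 0}.Finite := q.finite_setOfPred_isRoot hq
  exact hf.infinite_compl

theorem revPoly_eq_prod {c : ℕ → ℂ} {m J : ℕ} {r : Fin J → ℂ} {μ : Fin J → ℕ} (hμ : ∑ j, μ j = m)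
    (h : ∀ z : ℂ, charPoly c m z = c m * ∏ j, (z - r j) ^ μ j) :
    revPoly c m = C (c m) * ∏ j, (1 - C (r j) * X) ^ μ j := by
  refine eq_of_infinite_eval_eq _ _ ((infinite_eval_ne_zero X_ne_zero).mono fun w hw => ?_)
  have hw' : w ≠ 0 := by simpa using hw
  change (revPoly c m).eval w = _
  rw [eval_revPoly c m hw', h, ← hμ, ← Finset.prod_pow_eq_pow_sum, mul_left_comm,
    ← Finset.prod_mul_distrib]
  simp only [eval_mul, eval_C, eval_prod, eval_pow, eval_sub, eval_one, eval_X, ← mul_pow]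
  congr 1
  refine Finset.prod_congr rfl fun j _ => ?_
  rw [mul_sub, mul_inv_cancel₀ hw', mul_comm w]

/-- The polynomial obtained by clearing denominators in a sum of partial fractions in `X⁻¹`. -/
def clearedSum (a : ℂ) {J : ℕ} (r : Fin J → ℂ) (μ : Fin J → ℕ) (e : ℂ) (b : Fin J → ℕ → ℂ) :
    ℂ[X] :=
  C e * (C a * ∏ j, (1 - C (r j) * X) ^ μ j) +
    ∑ j, ∑ i ∈ Finset.Icc 1 (μ j), C (b j i) * (C a * (X ^ i * (1 - C (r j) * X) ^ (μ j - i) *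
      ∏ k ∈ Finset.univ.erase j, (1 - C (r k) * X) ^ μ k))

/-- The relation for `l j` gives `(1 - r x) ^ μ * l ^ i = x ^ i * (1 - r x) ^ (μ - i)`, so
denominators clear without division. It is used in `ℂ` to verify a polynomial identity and then in
`A` to evaluate it. -/
theorem aeval_clearedSum {A : Type*} [CommRing A] [Algebra ℂ A] {a : ℂ} {J : ℕ} {r : Fin J → ℂ}
    {μ : Fin J → ℕ} {e : ℂ} {b : Fin J → ℕ → ℂ} {x : A} {l : Fin J → A}
    (hl : ∀ j, l j * (1 - r j • x) = x) :
    aeval x (clearedSum a r μ e b) = aeval x (C a * ∏ j, (1 - C (r j) * X) ^ μ j) *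
      (e • 1 + ∑ j, ∑ i ∈ Finset.Icc 1 (μ j), b j i • l j ^ i) := by
  have hfac : ∀ j, aeval x (1 - C (r j) * X : ℂ[X]) = 1 - r j • x := fun j => by
    simp [Algebra.smul_def]
  rw [clearedSum, mul_add, Finset.mul_sum, map_add, map_sum]
  congr 1
  · rw [map_mul, aeval_C, Algebra.smul_def, mul_one, mul_comm]
  · refine Finset.sum_congr rfl fun j _ => ?_
    rw [map_sum, Finset.mul_sum]
    refine Finset.sum_congr rfl fun i hi => ?_
    have hi' := (Finset.mem_Icc.1 hi).2
    rw [← Finset.mul_prod_erase _ _ (Finset.mem_univ j), Algebra.smul_def]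
    simp only [map_mul, map_pow, aeval_C, aeval_X, hfac, map_prod]
    rw [← Nat.add_sub_cancel' hi', pow_add, Nat.add_sub_cancel_left]
    nth_rewrite 1 [← hl j]
    rw [mul_pow]
    ring

/-- The cleared partial fractions agree with `N` at all but finitely many `w`, hence as polynomials,
and can be evaluated at any `x`. The constant `e` is `1` for `P_0 / P_m` and `0` in the other cases.
-/
theorem aeval_revPoly_mul {A : Type*} [CommRing A] [Algebra ℂ A] {c : ℕ → ℂ} {m J : ℕ}
    (hc : c m ≠ 0) {r : Fin J → ℂ}
    {μ : Fin J → ℕ} (hμ : ∑ j, μ j = m) (hμ1 : ∀ j, 1 ≤ μ j)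
    (h : ∀ z : ℂ, charPoly c m z = c m * ∏ j, (z - r j) ^ μ j) {N : ℂ[X]} {num : ℂ → ℂ}
    (hN : ∀ w : ℂ, w ≠ 0 → N.eval w = w ^ m * num w⁻¹) {e : ℂ} {b : Fin J → ℕ → ℂ}
    (hb : ∀ z : ℂ, charPoly c m z ≠ 0 →
      num z / charPoly c m z = e + ∑ j, ∑ i ∈ Finset.Icc 1 (μ j), b j i / (z - r j) ^ i)
    {x : A} {l : Fin J → A} (hl : ∀ j, l j * (1 - r j • x) = x) :
    aeval x (revPoly c m) * (e • 1 + ∑ j, ∑ i ∈ Finset.Icc 1 (μ j), b j i • l j ^ i) =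
      aeval x N := by
  have hrev := revPoly_eq_prod hμ h
  have hne : revPoly c m ≠ 0 := by
    intro h0
    have := congrArg (eval 0) (hrev.symm.trans h0)
    simp [eval_prod, hc] at this
  rw [hrev, ← aeval_clearedSum hl]
  congr 1
  refine eq_of_infinite_eval_eq _ _
    ((infinite_eval_ne_zero (mul_ne_zero X_ne_zero hne)).mono fun w hw => ?_)
  obtain ⟨hw0, hwr⟩ : w ≠ 0 ∧ (revPoly c m).eval w ≠ 0 := by simpa using hw
  have hch : charPoly c m w⁻¹ ≠ 0 := by
    rw [eval_revPoly c m hw0] at hwr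
    exact right_ne_zero_of_mul hwr
  have hr : ∀ j, w⁻¹ - r j ≠ 0 := by
    intro j h0
    rw [h, Finset.prod_eq_zero (Finset.mem_univ j), mul_zero] at hch
    · exact hch rfl
    · rw [h0, zero_pow (by have := hμ1 j; omega)]
  -- In the algebra `ℂ` with `x = w`, the element playing `l j` is the actual fraction `1 / (w⁻¹ - r
  -- j)`.
  have hl' : ∀ j, (w⁻¹ - r j)⁻¹ * (1 - r j • w) = w := by
    intro j
    have : 1 - r j * w = (w⁻¹ - r j) * w := by field_simp
    rw [smul_eq_mul, this, inv_mul_cancel_left₀ (hr j)]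
  have key := aeval_clearedSum (a := c m) (r := r) (μ := μ) (e := e) (b := b) (x := w) hl'
  simp only [coe_aeval_eq_eval, ← hrev] at key
  change eval w _ = eval w N
  rw [key, hN w hw0, eval_revPoly c m hw0]
  have hb' := hb _ hch
  rw [div_eq_iff hch] at hb'
  rw [hb']
  simp only [smul_eq_mul, mul_one, inv_pow, div_eq_mul_inv]
  ring

theorem charPoly_eq_eval (c : ℕ → ℂ) (m : ℕ) (z : ℂ) :
    charPoly c m z = (∑ p ∈ Finset.range (m + 1), C (c p) * X ^ p : ℂ[X]).eval z := by
  simp [charPoly, eval_finsetSum]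

theorem initPoly_zero (c : ℕ → ℂ) (m : ℕ) (z : ℂ) :
    initPoly c m 0 z = charPoly c m z - c 0 := by
  rw [charPoly, initPoly, Finset.range_eq_Ico, Finset.sum_eq_sum_Ico_succ_bot (by omega)]
  simp only [Nat.sub_zero, zero_add, pow_zero, mul_one, add_sub_cancel_left]
  rfl

theorem degree_linear_prod_lt {J : ℕ} (r : Fin J → ℂ) (μ : Fin J → ℕ) (j : Fin J) (a : ℂ) {i : ℕ}
    (hi : i < μ j) :
    (C a * (X - C (r j)) ^ i * ∏ k ∈ Finset.univ.erase j, (X - C (r k)) ^ μ k : ℂ[X]).degree <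
      (∑ j, μ j : ℕ) := by
  refine lt_of_le_of_lt degree_le_natDegree (Nat.cast_lt.2 ?_)
  have h1 : (∏ k ∈ Finset.univ.erase j, (X - C (r k)) ^ μ k : ℂ[X]).natDegree ≤
      ∑ k ∈ Finset.univ.erase j, μ k :=
    (natDegree_prod_le _ _).trans (Finset.sum_le_sum fun k _ => by simp)
  have h2 : (C a * (X - C (r j)) ^ i : ℂ[X]).natDegree ≤ i :=
    (natDegree_C_mul_le _ _).trans (by simp)
  rw [← Finset.add_sum_erase _ _ (Finset.mem_univ j)]
  exact lt_of_le_of_lt natDegree_mul_le (by omega)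

/-- Partial fractions with scalar coefficients for a product of powers of distinct linear factors. -/
theorem exists_partialFractions {J : ℕ} {r : Fin J → ℂ} (hr : Function.Injective r) (μ : Fin J → ℕ)
    {N : ℂ[X]} (hN : N.degree < (∑ j, μ j : ℕ)) :
    ∃ b : Fin J → ℕ → ℂ, ∀ z : ℂ, (∏ j, (z - r j) ^ μ j) ≠ 0 →
      N.eval z / ∏ j, (z - r j) ^ μ j = ∑ j, ∑ i ∈ Finset.Icc 1 (μ j), b j i / (z - r j) ^ i := by
  obtain ⟨q, R, hR, hf⟩ := eq_quo_mul_prod_pow_add_sum_rem_mul_prod_pow (s := Finset.univ) N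
    (g := fun j => X - C (r j)) (fun j _ => monic_X_sub_C _)
    ((pairwise_coprime_X_sub_C hr).set_pairwise _) μ
  have hRC : ∀ j i, R j i = C ((R j i).coeff 0) := fun j i =>
    eq_C_of_degree_le_zero (by
      have := hR j (Finset.mem_univ j) i
      rw [degree_X_sub_C] at this
      exact Order.lt_succ_iff.1 this)
  -- A nonzero quotient would give the product degree at least `∑ μ j`, while `N` and all remainder
  -- terms have smaller degree.
  have hq : q = 0 := by
    by_contra hq
    have hmonic : (∏ j, (X - C (r j)) ^ μ j : ℂ[X]).Monic :=
      monic_prod_of_monic _ _ fun j _ => (monic_X_sub_C _).pow _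
    have hdeg : (∏ j, (X - C (r j)) ^ μ j : ℂ[X]).degree = (∑ j, μ j : ℕ) := by
      rw [degree_eq_natDegree hmonic.ne_zero,
        natDegree_prod_of_monic _ _ fun j _ => (monic_X_sub_C _).pow _]
      simp
    have h1 : (q * ∏ j, (X - C (r j)) ^ μ j : ℂ[X]).degree < (∑ j, μ j : ℕ) := by
      rw [← sub_eq_iff_eq_add] at hf
      rw [← hf]
      refine lt_of_le_of_lt (degree_sub_le _ _) (max_lt hN ?_)
      refine lt_of_le_of_lt (degree_sum_le _ _)
        ((Finset.sup_lt_iff (WithBot.bot_lt_coe _)).2 fun j _ => ?_)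
      refine lt_of_le_of_lt (degree_sum_le _ _)
        ((Finset.sup_lt_iff (WithBot.bot_lt_coe _)).2 fun i _ => ?_)
      rw [hRC]
      exact degree_linear_prod_lt r μ j _ i.2
    rw [degree_mul, hdeg, degree_eq_natDegree hq, ← Nat.cast_add, Nat.cast_lt] at h1
    omega
  set a : Fin J → ℕ → ℂ := fun j i => if h : i < μ j then (R j ⟨i, h⟩).coeff 0 else 0 with ha
  -- The remainder at `(X - r j) ^ i` becomes, after division, the coefficient of the pole of order
  -- `μ j - i`; hence the reversed index.
  refine ⟨fun j i => a j (μ j - i), fun z hz => ?_⟩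
  have hzj : ∀ j, (z - r j) ^ μ j ≠ 0 := fun j => Finset.prod_ne_zero_iff.1 hz j (Finset.mem_univ j)
  rw [hf, hq, zero_mul, zero_add, eval_finsetSum, Finset.sum_div]
  refine Finset.sum_congr rfl fun j _ => ?_
  have h1 : ∀ i : Fin (μ j), (R j i * (X - C (r j)) ^ i.1 *
      ∏ k ∈ Finset.univ.erase j, (X - C (r k)) ^ μ k).eval z / ∏ j, (z - r j) ^ μ j =
      a j i / (z - r j) ^ (μ j - i) := by
    intro i
    have hrest : ∏ k ∈ Finset.univ.erase j, (z - r k) ^ μ k ≠ 0 :=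
      Finset.prod_ne_zero_iff.2 fun k _ => hzj k
    have hzr : z - r j ≠ 0 := fun h0 => hzj j (by rw [h0, zero_pow (by have := i.2; omega)])
    rw [hRC, ← Finset.mul_prod_erase _ _ (Finset.mem_univ j), ha]
    simp only [i.2, dif_pos, eval_mul, eval_C, eval_pow, eval_sub, eval_X, eval_prod]
    rw [mul_div_mul_right _ _ hrest]
    nth_rewrite 2 [← Nat.sub_add_cancel i.2.le]
    rw [pow_add, mul_div_mul_right _ _ (pow_ne_zero _ hzr)]
  rw [eval_finsetSum, Finset.sum_div, Finset.sum_congr rfl fun i _ => h1 i,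
    Fin.sum_univ_eq_sum_range (fun i => a j i / (z - r j) ^ (μ j - i)) (μ j)]
  refine Finset.sum_nbij' (fun i => μ j - i) (fun i => μ j - i) ?_ ?_ ?_ ?_ ?_
  all_goals intro i hi
  all_goals simp only [Finset.mem_range, Finset.mem_Icc] at hi ⊢
  any_goals omega
  rw [Nat.sub_sub_self hi.le]

theorem exists_isPartialFractions (c : ℕ → ℂ) {m : ℕ} (hm : 1 ≤ m) (hc : c m ≠ 0) :
    ∃ (J : ℕ) (r : Fin J → ℂ) (μ : Fin J → ℕ) (a : Fin J → ℕ → ℂ) (b : ℕ → Fin J → ℕ → ℂ),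
      IsPartialFractions c m J r μ a b := by
  classical
  set P : ℂ[X] := ∑ p ∈ Finset.range (m + 1), C (c p) * X ^ p with hP
  have hcoeff : ∀ p ≤ m, P.coeff p = c p := by
    intro p hp
    simp [hP, coeff_X_pow]
    omega
  have hdle : P.natDegree ≤ m := natDegree_sum_le_of_forall_le _ _ fun p hp =>
    (natDegree_C_mul_X_pow_le _ _).trans (Nat.lt_succ_iff.1 (Finset.mem_range.1 hp))
  have hdeg : P.natDegree = m :=
    natDegree_eq_of_le_of_coeff_ne_zero hdle (by rwa [hcoeff m le_rfl])
  have hlead : P.leadingCoeff = c m := by rw [leadingCoeff, hdeg, hcoeff m le_rfl]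
  have hsplit : P.Splits := IsAlgClosed.splits P
  set s := P.roots.toFinset
  set r : Fin s.card → ℂ := fun j => (s.equivFin.symm j : ℂ) with hr
  set μ : Fin s.card → ℕ := fun j => P.roots.count (r j) with hμ
  have hinj : Function.Injective r := Subtype.val_injective.comp s.equivFin.symm.injective
  have hmem : ∀ j, r j ∈ P.roots := fun j => Multiset.mem_toFinset.1 (s.equivFin.symm j).2
  have hsum : ∑ j, μ j = m := by
    rw [← hdeg, hsplit.natDegree_eq_card_roots, ← Multiset.toFinset_sum_count_eq,
      ← Finset.sum_coe_sort s]
    exact s.equivFin.symm.sum_comp fun x : s => P.roots.count (x : ℂ)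
  have hfac : ∀ z : ℂ, charPoly c m z = c m * ∏ j, (z - r j) ^ μ j := by
    intro z
    rw [charPoly_eq_eval, ← hP, hsplit.eval_eq_prod_roots, hlead, Finset.prod_multiset_map_count,
      ← Finset.prod_coe_sort]
    exact congrArg _ (s.equivFin.symm.prod_comp
      fun x : s => (z - (x:ℂ)) ^ P.roots.count (x : ℂ)).symm
  have hdiv : ∀ (N : ℂ[X]), N.degree < m → ∃ b : Fin s.card → ℕ → ℂ, ∀ z : ℂ,
      charPoly c m z ≠ 0 → N.eval z / charPoly c m z =
        ∑ j, ∑ i ∈ Finset.Icc 1 (μ j), b j i / (z - r j) ^ i := by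
    intro N hN
    obtain ⟨b, hb⟩ := exists_partialFractions hinj μ (N := C (c m)⁻¹ * N)
      (by rw [hsum, degree_C_mul (inv_ne_zero hc)]; exact hN)
    refine ⟨b, fun z hz => ?_⟩
    rw [hfac] at hz ⊢
    rw [← hb z (right_ne_zero_of_mul hz), eval_mul, eval_C]
    field_simp
  obtain ⟨a, ha⟩ := hdiv 1 (by rw [degree_one]; exact_mod_cast hm)
  have hb : ∀ p : ℕ, ∃ b : Fin s.card → ℕ → ℂ, 1 ≤ p → p < m → ∀ z : ℂ, charPoly c m z ≠ 0 →
      initPoly c m p z / charPoly c m z =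
        ∑ j, ∑ i ∈ Finset.Icc 1 (μ j), b j i / (z - r j) ^ i := by
    intro p
    by_cases hp : 1 ≤ p ∧ p < m
    · obtain ⟨b, hb⟩ := hdiv (∑ j ∈ Finset.Icc 1 (m - p), C (c (p + j)) * X ^ j) (by
        refine lt_of_le_of_lt (degree_le_of_natDegree_le (n := m - p) ?_)
          (Nat.cast_lt.2 (by omega))
        exact natDegree_sum_le_of_forall_le _ _ fun j hj =>
          (natDegree_C_mul_X_pow_le _ _).trans (Finset.mem_Icc.1 hj).2)
      refine ⟨b, fun _ _ z hz => ?_⟩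
      rw [← hb z hz]
      simp [initPoly, eval_finsetSum]
    · exact ⟨0, fun h1 h2 => absurd ⟨h1, h2⟩ hp⟩
  choose b hb using hb
  -- Since `P_0 = P_m - c_0`, one has `P_0 / P_m = 1 - c_0 / P_m`, so the coefficients for `p = 0`
  -- are `-c_0` times those of `1 / P_m`.
  refine ⟨s.card, r, μ, a, fun p => if p = 0 then fun j i => -c 0 * a j i else b p, hinj,
    fun j => Multiset.one_le_count_iff_mem.2 (hmem j), hsum, hfac, ?_, ?_, ?_⟩
  · intro z hz
    simpa using ha z hz
  · intro z hz
    rw [initPoly_zero, sub_div, div_self hz]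
    have h1 := ha z hz
    rw [eval_one] at h1
    rw [sub_eq_add_neg, ← mul_one (c 0), mul_div_assoc, h1, ← neg_mul, Finset.mul_sum]
    simp only [if_true, Finset.mul_sum, mul_div_assoc, mul_one]
  · intro p hp hpm z hz
    simp only [if_neg (show p ≠ 0 by omega)]
    exact hb p hp hpm z hz

end PartialFractions

/-! ### Solving the chain problem and returning to functions. -/

section Solutions

open Polynomial

theorem aeval_revPoly {A : Type*} [CommRing A] [Algebra ℂ A] (c : ℕ → ℂ) (m : ℕ) (x : A) :
    aeval x (revPoly c m) = ∑ p ∈ Finset.range (m + 1), c p • x ^ (m - p) := by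
  simp [revPoly, Algebra.smul_def]

theorem aeval_revInitPoly {A : Type*} [CommRing A] [Algebra ℂ A] (c : ℕ → ℂ) (m p : ℕ) (x : A) :
    aeval x (revInitPoly c m p) = ∑ j ∈ Finset.Icc 1 (m - p), c (p + j) • x ^ (m - j) := by
  simp [revInitPoly, Algebra.smul_def]

theorem sum_range_sum_range {M : Type*} [AddCommMonoid M] (m : ℕ) (F : ℕ → ℕ → M) :
    ∑ p ∈ Finset.range (m + 1), ∑ q ∈ Finset.range p, F p q =
      ∑ q ∈ Finset.range m, ∑ j ∈ Finset.Icc 1 (m - q), F (q + j) q := by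
  rw [Finset.sum_sigma', Finset.sum_sigma']
  refine Finset.sum_nbij' (fun x => ⟨x.2, x.1 - x.2⟩) (fun x => ⟨x.1 + x.2, x.1⟩) ?_ ?_ ?_ ?_ ?_
  all_goals rintro ⟨p, q⟩ h
  all_goals simp only [Finset.mem_sigma, Finset.mem_range, Finset.mem_Icc] at h ⊢
  any_goals omega
  · congr 1; omega
  · congr 1; omega
  · rw [Nat.add_sub_cancel' h.2.le]

theorem chain_zero_eq {A : Type*} [CommRing A] {x : A} {m : ℕ} {Γ Y : ℕ → A}
    (hY : ∀ p < m, Y p = x * Y (p + 1) + Γ p) (p : ℕ) (hp : p ≤ m) :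
    Y 0 = ∑ q ∈ Finset.range p, x ^ q * Γ q + x ^ p * Y p := by
  induction p with
  | zero => simp
  | succ p ih =>
    rw [ih (by omega), hY p hp, Finset.sum_range_succ, pow_succ]
    ring

section Chain

variable {A : Type*} [CommRing A] [Algebra ℂ A] {x φ : A} {c : ℕ → ℂ} {m : ℕ} {Γ Y : ℕ → A}

/-- The initial element of a chain solving the equation is determined up to the characteristic
factor. -/
theorem aeval_revPoly_mul_chain (hY : ∀ p < m, Y p = x * Y (p + 1) + Γ p)
    (hs : ∑ p ∈ Finset.range (m + 1), c p • Y p = φ) :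
    aeval x (revPoly c m) * Y 0 =
      x ^ m * φ + ∑ q ∈ Finset.range m, aeval x (revInitPoly c m q) * Γ q := by
  have h1 : ∀ p ∈ Finset.range (m + 1), (c p • x ^ (m - p)) * Y 0 =
      x ^ m * c p • Y p + ∑ q ∈ Finset.range p, c p • (x ^ (m - p + q) * Γ q) := by
    intro p hp
    have hp' : p ≤ m := Nat.lt_succ_iff.1 (Finset.mem_range.1 hp)
    rw [chain_zero_eq hY p hp', mul_add, Finset.mul_sum, add_comm]
    congr 1
    · rw [smul_mul_assoc, ← mul_assoc, ← pow_add, Nat.sub_add_cancel hp', mul_smul_comm]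
    · refine Finset.sum_congr rfl fun q _ => ?_
      rw [smul_mul_assoc, ← mul_assoc, ← pow_add]
  rw [aeval_revPoly, Finset.sum_mul, Finset.sum_congr rfl h1, Finset.sum_add_distrib,
    ← Finset.mul_sum, hs, sum_range_sum_range]
  congr 1
  refine Finset.sum_congr rfl fun q _ => ?_
  rw [aeval_revInitPoly, Finset.sum_mul]
  refine Finset.sum_congr rfl fun j hj => ?_
  obtain ⟨hj1, hj2⟩ := Finset.mem_Icc.1 hj
  rw [smul_mul_assoc]
  congr 3
  omega

/-- `S` is the chain ending in `0`; the general chain with last entry `u` is `S p + x ^ (m - p) *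
u`. The equation then reads `Q(x) * u = φ - ∑ c_p S p`, with `Q(x)` a unit. The ideal `I` keeps the
entries free of the adjoined unit, although the inverse of `Q(x)` involves it. -/
theorem exists_chain (I : Ideal A) (hΓ : ∀ p, Γ p ∈ I) (hφ : φ ∈ I)
    (hu : IsUnit (aeval x (revPoly c m))) :
    ∃ Y : ℕ → A, (∀ p, Y p ∈ I) ∧ (∀ p < m, Y p = x * Y (p + 1) + Γ p) ∧
      ∑ p ∈ Finset.range (m + 1), c p • Y p = φ := by
  obtain ⟨v, hv⟩ := hu.exists_right_inv
  set S : ℕ → A := fun p => ∑ q ∈ Finset.Ico p m, x ^ (q - p) * Γ q with hS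
  set u : A := v * (φ - ∑ p ∈ Finset.range (m + 1), c p • S p) with hu'
  have hSI : ∀ p, S p ∈ I := fun p => I.sum_mem fun q _ => I.mul_mem_left _ (hΓ q)
  have huI : u ∈ I := I.mul_mem_left _ (I.sub_mem hφ (I.sum_mem fun p _ => by
    rw [Algebra.smul_def]; exact I.mul_mem_left _ (hSI p)))
  refine ⟨fun p => S p + x ^ (m - p) * u, fun p => I.add_mem (hSI p) (I.mul_mem_left _ huI),
    fun p hp => ?_, ?_⟩
  · have h1 : S p = x * S (p + 1) + Γ p := by
      simp only [hS]
      rw [Finset.sum_eq_sum_Ico_succ_bot hp, Nat.sub_self, pow_zero, one_mul, add_comm,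
        Finset.mul_sum]
      congr 1
      refine Finset.sum_congr rfl fun q hq => ?_
      have := (Finset.mem_Ico.1 hq).1
      rw [← mul_assoc, ← pow_succ']
      congr 2
      omega
    have h2 : x ^ (m - p) = x * x ^ (m - (p + 1)) := by
      rw [← pow_succ']
      congr 1
      omega
    beta_reduce
    rw [h1, h2]
    ring
  · have h3 : ∑ p ∈ Finset.range (m + 1), c p • (x ^ (m - p) * u) =
        aeval x (revPoly c m) * u := by
      rw [aeval_revPoly, Finset.sum_mul]
      simp only [smul_mul_assoc]
    simp only [smul_add, Finset.sum_add_distrib]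
    rw [h3, hu', ← mul_assoc, hv, one_mul, add_sub_cancel]

end Chain

open ConvAlg

/-- The canonical embedding of the convolution algebra into its unitization, as a linear map. -/
def emb : ConvAlg →ₗ[ℂ] UnitConvAlg where
  toFun f := Unitization.inr f
  map_add' := Unitization.inr_add ℂ
  map_smul' a f := Unitization.inr_smul ℂ a f

theorem emb_injective : Function.Injective emb :=
  fun _ _ h => Unitization.inr_injective (R := ℂ) h

theorem emb_mul (f g : ConvAlg) : emb (f * g) = emb f * emb g := Unitization.inr_mul ℂ f g

theorem isUnit_one_sub_smul {g : ℝ → ℂ} (hg : g ∈ CNegOne) (z : ℂ) :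
    IsUnit (1 - z • emb (ofMem hg)) := by
  refine IsUnit.of_mul_eq_one (1 + z • emb (ofMem (CNegOne.convSeries hg z))) ?_
  rw [mul_comm, add_mul, one_mul, smul_mul_assoc]
  have := ofMem_convSeries_mul hg z
  change emb _ * (1 - z • emb _) = emb _ at this
  rw [this, sub_add_cancel]

theorem isUnit_aeval_revPoly {g : ℝ → ℂ} (hg : g ∈ CNegOne) {c : ℕ → ℂ} {m J : ℕ} (hc : c m ≠ 0)
    {r : Fin J → ℂ} {μ : Fin J → ℕ} (hμ : ∑ j, μ j = m)
    (h : ∀ z : ℂ, charPoly c m z = c m * ∏ j, (z - r j) ^ μ j) :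
    IsUnit (aeval (emb (ofMem hg)) (revPoly c m)) := by
  rw [revPoly_eq_prod hμ h, map_mul, map_prod, aeval_C]
  refine IsUnit.mul ((isUnit_iff_ne_zero.2 hc).map _) (IsUnit.prod_univ_iff.2 fun j => ?_)
  rw [map_pow]
  refine IsUnit.pow _ ?_
  have := isUnit_one_sub_smul hg (r j)
  simpa [Algebra.smul_def] using this

theorem exists_isSolution {n m : ℕ} {κ k : ℝ → ℂ} (hn : 1 ≤ n) (hκk : KernelPair n κ k)
    {c : ℕ → ℂ} (hu : IsUnit (aeval (emb (ofMem hκk.left_mem)) (revPoly c m)))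
    {f : ℝ → ℂ} {γ : ℕ → ℝ → ℂ} {Φ : ConvAlg} (hΦ : ∀ t, 0 < t → (Φ : ℝ → ℂ) t = f t)
    {Γ : ℕ → ConvAlg} (hΓ : ∀ p < m, ∀ t, 0 < t → (Γ p : ℝ → ℂ) t = γ p t)
    (hΓk : ∀ p < m, HasGfd n k (Γ p) 0) :
    ∃ y : ℝ → ℂ, IsSolution n m κ k c f γ y := by
  obtain ⟨Z, hZI, hZ, hZs⟩ := exists_chain (x := emb (ofMem hκk.left_mem)) (φ := emb Φ) (c := c)
    (m := m) (Γ := fun p => emb (Γ p)) (RingHom.ker (Unitization.fstHom ℂ ConvAlg))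
    (fun p => RingHom.mem_ker.2 (Unitization.fst_inr ℂ (Γ p)))
    (RingHom.mem_ker.2 (Unitization.fst_inr ℂ Φ)) hu
  have hZe : ∀ p, emb (Z p).snd = Z p := fun p => Unitization.ext (by
    have : (Z p).fst = 0 := hZI p
    rw [this]; exact Unitization.fst_inr ℂ _) rfl
  refine ⟨(Z 0).snd, (isSolution_iff hn hκk hΦ hΓ hΓk).2 ⟨fun p => (Z p).snd, fun _ _ => rfl,
    fun p hp => emb_injective ?_, emb_injective ?_⟩⟩
  · rw [map_add, emb_mul, hZe, hZe]
    exact hZ p hp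
  · rw [map_sum, ← hZs]
    exact Finset.sum_congr rfl fun p _ => by rw [map_smul, hZe]

theorem IsSolution.eq_of_aeval_mul_eq {n m : ℕ} {κ k : ℝ → ℂ} (hn : 1 ≤ n)
    (hκk : KernelPair n κ k)
    {c : ℕ → ℂ} (hu : IsUnit (aeval (emb (ofMem hκk.left_mem)) (revPoly c m)))
    {f : ℝ → ℂ} {γ : ℕ → ℝ → ℂ} {Φ : ConvAlg} (hΦ : ∀ t, 0 < t → (Φ : ℝ → ℂ) t = f t)
    {Γ : ℕ → ConvAlg} (hΓ : ∀ p < m, ∀ t, 0 < t → (Γ p : ℝ → ℂ) t = γ p t)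
    (hΓk : ∀ p < m, HasGfd n k (Γ p) 0) {y : ℝ → ℂ} (hy : IsSolution n m κ k c f γ y)
    {S : ConvAlg} (hS : aeval (emb (ofMem hκk.left_mem)) (revPoly c m) * emb S =
      emb (ofMem hκk.left_mem) ^ m * emb Φ +
        ∑ q ∈ Finset.range m, aeval (emb (ofMem hκk.left_mem)) (revInitPoly c m q) * emb (Γ q))
    {t : ℝ} (ht : 0 < t) : y t = (S : ℝ → ℂ) t := by
  obtain ⟨Y, hY0, hY, hYs⟩ := (isSolution_iff hn hκk hΦ hΓ hΓk).1 hy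
  have h := aeval_revPoly_mul_chain (c := c) (x := emb (ofMem hκk.left_mem))
    (Γ := fun p => emb (Γ p)) (Y := fun p => emb (Y p)) (φ := emb Φ)
    (fun p hp => by rw [hY p hp, map_add, emb_mul])
    (by rw [← hYs, map_sum]; simp only [map_smul])
  rw [hY0 t ht, emb_injective (hu.mul_left_cancel (h.trans hS.symm))]

/-- The candidate `S` is never differentiated: some solution exists, any solution satisfies the
equation that determines `S`, so that solution is `S`. -/
theorem isUniqueSolution_of_aeval_mul_eq {n m : ℕ} {κ k : ℝ → ℂ} (hn : 1 ≤ n)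
    (hκk : KernelPair n κ k)
    {c : ℕ → ℂ} (hu : IsUnit (aeval (emb (ofMem hκk.left_mem)) (revPoly c m)))
    {f : ℝ → ℂ} {γ : ℕ → ℝ → ℂ} {Φ : ConvAlg} (hΦ : ∀ t, 0 < t → (Φ : ℝ → ℂ) t = f t)
    {Γ : ℕ → ConvAlg} (hΓ : ∀ p < m, ∀ t, 0 < t → (Γ p : ℝ → ℂ) t = γ p t)
    (hΓk : ∀ p < m, HasGfd n k (Γ p) 0)
    {S : ConvAlg} (hS : aeval (emb (ofMem hκk.left_mem)) (revPoly c m) * emb S =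
      emb (ofMem hκk.left_mem) ^ m * emb Φ +
        ∑ q ∈ Finset.range m, aeval (emb (ofMem hκk.left_mem)) (revInitPoly c m q) * emb (Γ q))
    {y : ℝ → ℂ} (hy : ∀ t, 0 < t → y t = (S : ℝ → ℂ) t) : IsUniqueSolution n m κ k c f γ y := by
  have heq : ∀ y', IsSolution n m κ k c f γ y' → ∀ t, 0 < t → y' t = y t := fun y' hy' t ht => by
    rw [hy t ht, hy'.eq_of_aeval_mul_eq hn hκk hu hΦ hΓ hΓk hS ht]
  refine ⟨?_, heq⟩
  obtain ⟨y₀, hy₀⟩ := exists_isSolution hn hκk hu hΦ hΓ hΓk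
  obtain ⟨Y, hY0, hY⟩ := (isSolution_iff hn hκk hΦ hΓ hΓk).1 hy₀
  exact (isSolution_iff hn hκk hΦ hΓ hΓk).2
    ⟨Y, fun t ht => by rw [← heq y₀ hy₀ t ht, hY0 t ht], hY⟩

theorem convPow_mem {g : ℝ → ℂ} (hg : g ∈ CNegOne) : ∀ i, convPow g i ∈ CNegOne
  | 0 => ⟨0, by norm_num, fun _ => 1, continuousOn_const, fun t _ => by simp [convPow]⟩
  | i + 1 => CNegOne.convPow hg i

/-- The condition `1 ≤ i` matters: `convPow g 0` is the constant function `1`, not the adjoined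
unit. -/
theorem emb_ofMem_convPow {g : ℝ → ℂ} (hg : g ∈ CNegOne) {i : ℕ} (hi : 1 ≤ i) :
    emb (ofMem (convPow_mem hg i)) = emb (ofMem hg) ^ i := by
  obtain ⟨i, rfl⟩ : ∃ j, i = j + 1 := ⟨i - 1, by omega⟩
  exact inr_ofMem_convPow hg i

/-- The convolution of `φ` with a combination of the powers of the series `l_{κ,r_j}`. -/
def fracSum {κ : ℝ → ℂ} (hκ : κ ∈ CNegOne) {J : ℕ} (r : Fin J → ℂ) (μ : Fin J → ℕ)
    (b : Fin J → ℕ → ℂ) (φ : ConvAlg) : ConvAlg :=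
  ∑ j, ∑ i ∈ Finset.Icc 1 (μ j),
    b j i • (φ * ofMem (convPow_mem (CNegOne.convSeries hκ (r j)) i))

theorem coe_sum_apply {ι : Type*} (s : Finset ι) (F : ι → ConvAlg) (t : ℝ) :
    ((∑ i ∈ s, F i : ConvAlg) : ℝ → ℂ) t = ∑ i ∈ s, (F i : ℝ → ℂ) t := by
  rw [AddSubmonoidClass.coe_finsetSum, Finset.sum_apply]

theorem fracSum_apply {κ : ℝ → ℂ} (hκ : κ ∈ CNegOne) {J : ℕ} (r : Fin J → ℂ) (μ : Fin J → ℕ)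
    (b : Fin J → ℕ → ℂ) {φ : ConvAlg} {f : ℝ → ℂ} (hφ : ∀ t, 0 < t → (φ : ℝ → ℂ) t = f t) {t : ℝ}
    (ht : 0 < t) : (fracSum hκ r μ b φ : ℝ → ℂ) t =
      ∑ j, ∑ i ∈ Finset.Icc 1 (μ j), b j i * conv f (convPow (convSeries κ (r j)) i) t := by
  simp only [fracSum, coe_sum_apply]
  refine Finset.sum_congr rfl fun j _ => Finset.sum_congr rfl fun i _ => ?_
  exact congrArg (b j i * ·) (conv_congr hφ (fun s hs => ofMem_apply _ hs) ht)

theorem emb_fracSum {κ : ℝ → ℂ} (hκ : κ ∈ CNegOne) {J : ℕ} (r : Fin J → ℂ) (μ : Fin J → ℕ)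
    (b : Fin J → ℕ → ℂ) (φ : ConvAlg) : emb (fracSum hκ r μ b φ) = emb φ *
      ∑ j, ∑ i ∈ Finset.Icc 1 (μ j), b j i • emb (ofMem (CNegOne.convSeries hκ (r j))) ^ i := by
  simp only [fracSum, map_sum, Finset.mul_sum]
  refine Finset.sum_congr rfl fun j _ => Finset.sum_congr rfl fun i hi => ?_
  rw [map_smul, emb_mul, emb_ofMem_convPow _ (Finset.mem_Icc.1 hi).1, mul_smul_comm]

theorem aeval_revPoly_mul_source {κ : ℝ → ℂ} (hκ : κ ∈ CNegOne) {c : ℕ → ℂ} {m J : ℕ}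
    (hc : c m ≠ 0) {r : Fin J → ℂ} {μ : Fin J → ℕ} {a : Fin J → ℕ → ℂ} {b : ℕ → Fin J → ℕ → ℂ}
    (h : IsPartialFractions c m J r μ a b) (φ : ConvAlg) :
    aeval (emb (ofMem hκ)) (revPoly c m) * emb (fracSum hκ r μ a φ) =
      emb (ofMem hκ) ^ m * emb φ := by
  have key := aeval_revPoly_mul hc h.mult_sum h.mult_pos h.factor (N := X ^ m) (num := fun _ => 1)
    (fun w _ => by simp) (e := 0) (b := a) (fun z hz => by rw [zero_add]; exact h.inv_eq z hz)
    (fun j => ofMem_convSeries_mul hκ (r j))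
  rw [zero_smul, zero_add, map_pow, aeval_X] at key
  rw [emb_fracSum, mul_left_comm, mul_comm _ (emb φ)]
  exact congrArg (emb φ * ·) key

theorem aeval_revPoly_mul_init {κ : ℝ → ℂ} (hκ : κ ∈ CNegOne) {c : ℕ → ℂ} {m J : ℕ}
    (hc : c m ≠ 0) {r : Fin J → ℂ} {μ : Fin J → ℕ} {a : Fin J → ℕ → ℂ} {b : ℕ → Fin J → ℕ → ℂ}
    (h : IsPartialFractions c m J r μ a b) (hm : 1 ≤ m) (Γ : ℕ → ConvAlg) :
    aeval (emb (ofMem hκ)) (revPoly c m) *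
        emb (Γ 0 + ∑ p ∈ Finset.range m, fracSum hκ r μ (b p) (Γ p)) =
      ∑ q ∈ Finset.range m, aeval (emb (ofMem hκ)) (revInitPoly c m q) * emb (Γ q) := by
  have h0 := aeval_revPoly_mul hc h.mult_sum h.mult_pos h.factor (e := 1)
    (fun w hw => eval_revInitPoly c m 0 hw) h.zero_eq (fun j => ofMem_convSeries_mul hκ (r j))
  have hp : ∀ p, 1 ≤ p → p < m → _ := fun p hp hpm =>
    aeval_revPoly_mul hc h.mult_sum h.mult_pos h.factor (e := 0)
      (fun w hw => eval_revInitPoly c m p hw)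
      (fun z hz => by rw [zero_add]; exact h.pos_eq p hp hpm z hz)
      (fun j => ofMem_convSeries_mul hκ (r j))
  -- The index `p = 0` is split off: the separate summand `Γ 0` supplies the constant `1` of `P_0 /
  -- P_m`.
  obtain ⟨m', rfl⟩ : ∃ m', m = m' + 1 := ⟨m - 1, by omega⟩
  rw [map_add, map_sum, Finset.sum_range_succ', Finset.sum_range_succ', mul_add, mul_add,
    Finset.mul_sum, add_comm, add_assoc]
  congr 1
  · refine Finset.sum_congr rfl fun p hpm => ?_
    have := hp (p + 1) (by omega) (by have := Finset.mem_range.1 hpm; omega)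
    rw [zero_smul, zero_add] at this
    rw [emb_fracSum, mul_left_comm, mul_comm _ (emb (Γ (p + 1)))]
    exact congrArg (emb (Γ (p + 1)) * ·) this
  · rw [emb_fracSum, mul_left_comm, mul_comm _ (emb (Γ 0)), ← mul_add, mul_comm _ (emb (Γ 0))]
    rw [one_smul, mul_add, mul_one] at h0
    rw [add_comm]
    exact congrArg (emb (Γ 0) * ·) h0

theorem KernelPair.hasGfd_zero {n : ℕ} {κ k : ℝ → ℂ} (hn : 1 ≤ n) (h : KernelPair n κ k) :
    HasGfd n k ((0 : ConvAlg) : ℝ → ℂ) 0 :=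
  (h.hasGfd_conv hn zero_mem_CNegOne).congr (fun t _ => by simp [conv]) fun _ _ => rfl

end Solutions

end GFD

end

theorem theorem9 (n m : ℕ) (hn : 1 ≤ n) (hm : 1 ≤ m)
    (κ k : ℝ → ℂ) (hκk : GFD.KernelPair n κ k) (hκ : κ ∈ GFD.CNegOneDeriv (n - 1))
    (c : ℕ → ℂ) (hc : c m ≠ 0)
    (f : ℝ → ℂ) (hf : f ∈ GFD.CNegOne)
    (γ : ℕ → ℝ → ℂ) (hγ : ∀ p < m, γ p ∈ GFD.gfdKer n k) :
    (∃ y : ℝ → ℂ, GFD.IsUniqueSolution n m κ k c f γ y) ∧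
    (∀ z : ℂ, (∀ t : ℝ, 0 < t → Summable fun j : ℕ => z ^ j * GFD.convPow κ (j + 1) t) ∧
      GFD.convSeries κ z ∈ GFD.CNegOne) ∧
    (∃ (J : ℕ) (r : Fin J → ℂ) (μ : Fin J → ℕ) (a : Fin J → ℕ → ℂ) (b : ℕ → Fin J → ℕ → ℂ),
      GFD.IsPartialFractions c m J r μ a b) ∧
    ∀ (J : ℕ) (r : Fin J → ℂ) (μ : Fin J → ℕ) (a : Fin J → ℕ → ℂ) (b : ℕ → Fin J → ℕ → ℂ),
      GFD.IsPartialFractions c m J r μ a b →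
        GFD.IsUniqueSolution n m κ k c f γ
          (fun t => GFD.sourceSol κ J r μ a f t + GFD.initSol κ m J r μ b γ t) ∧
        GFD.IsUniqueSolution n m κ k c f (fun _ _ => 0) (GFD.sourceSol κ J r μ a f) ∧
        GFD.IsUniqueSolution n m κ k c (fun _ => 0) γ (GFD.initSol κ m J r μ b γ) := by
  obtain ⟨Φ, hΦ⟩ : ∃ Φ : GFD.ConvAlg, ∀ t, 0 < t → (Φ : ℝ → ℂ) t = f t :=
    ⟨_, fun _ ht => GFD.ConvAlg.ofMem_apply hf ht⟩
  have hex : ∀ p, ∃ G : GFD.ConvAlg, p < m → ∀ t, 0 < t → (G : ℝ → ℂ) t = γ p t := fun p => by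
    by_cases hp : p < m
    · exact ⟨_, fun _ _ ht => GFD.ConvAlg.ofMem_apply (hγ p hp).1.1 ht⟩
    -- Nothing is assumed about `γ p` for `p ≥ m`, so `Γ p` is set to `0` there.
    · exact ⟨0, fun h => absurd h hp⟩
  choose Γ hΓ using hex
  have hΓk : ∀ p < m, GFD.HasGfd n k (Γ p) 0 := fun p hp =>
    GFD.HasGfd.congr ⟨((hγ p hp).1.2 0 zero_lt_one).1, (hγ p hp).2⟩ (hΓ p hp) fun _ _ => rfl
  have h0 : ∀ t : ℝ, 0 < t → ((0 : GFD.ConvAlg) : ℝ → ℂ) t = 0 := fun _ _ => rfl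
  have hz := hκk.hasGfd_zero hn
  have main : ∀ (J : ℕ) (r : Fin J → ℂ) (μ : Fin J → ℕ) (a : Fin J → ℕ → ℂ)
      (b : ℕ → Fin J → ℕ → ℂ), GFD.IsPartialFractions c m J r μ a b →
        GFD.IsUniqueSolution n m κ k c f γ
          (fun t => GFD.sourceSol κ J r μ a f t + GFD.initSol κ m J r μ b γ t) ∧
        GFD.IsUniqueSolution n m κ k c f (fun _ _ => 0) (GFD.sourceSol κ J r μ a f) ∧
        GFD.IsUniqueSolution n m κ k c (fun _ => 0) γ (GFD.initSol κ m J r μ b γ) := by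
    intro J r μ a b h
    have hu := GFD.isUnit_aeval_revPoly hκk.left_mem hc h.mult_sum h.factor
    have hsrc := GFD.aeval_revPoly_mul_source hκk.left_mem hc h Φ
    have hini := GFD.aeval_revPoly_mul_init hκk.left_mem hc h hm Γ
    have hfs : ∀ t, 0 < t → GFD.sourceSol κ J r μ a f t =
        (GFD.fracSum hκk.left_mem r μ a Φ : ℝ → ℂ) t := fun t ht =>
      (GFD.fracSum_apply hκk.left_mem r μ a hΦ ht).symm
    have hgs : ∀ t, 0 < t → GFD.initSol κ m J r μ b γ t = ((Γ 0 + ∑ p ∈ Finset.range m,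
        GFD.fracSum hκk.left_mem r μ (b p) (Γ p) : GFD.ConvAlg) : ℝ → ℂ) t := by
      intro t ht
      refine (congrArg₂ (· + ·) (hΓ 0 hm t ht) ?_).symm
      rw [GFD.coe_sum_apply]
      exact Finset.sum_congr rfl fun p hp =>
        GFD.fracSum_apply hκk.left_mem r μ (b p) (hΓ p (Finset.mem_range.1 hp)) ht
    refine ⟨?_, ?_, ?_⟩
    · refine GFD.isUniqueSolution_of_aeval_mul_eq hn hκk hu hΦ hΓ hΓk
        (S := GFD.fracSum hκk.left_mem r μ a Φ +
          (Γ 0 + ∑ p ∈ Finset.range m, GFD.fracSum hκk.left_mem r μ (b p) (Γ p))) ?_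
        fun t ht => congrArg₂ (· + ·) (hfs t ht) (hgs t ht)
      rw [map_add GFD.emb, mul_add, hsrc, hini]
    · refine GFD.isUniqueSolution_of_aeval_mul_eq hn hκk hu hΦ (Γ := fun _ => 0)
        (fun _ _ => h0) (fun _ _ => hz) ?_ hfs
      rw [hsrc]
      simp
    · refine GFD.isUniqueSolution_of_aeval_mul_eq hn hκk hu (Φ := 0) h0 hΓ hΓk ?_ hgs
      rw [hini]
      simp
  obtain ⟨J, r, μ, a, b, h⟩ := GFD.exists_isPartialFractions c hm hc
  exact ⟨⟨_, (main J r μ a b h).1⟩, fun z => ⟨fun t ht =>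
    GFD.summable_convSeries hκk.left_mem z ht, GFD.CNegOne.convSeries hκk.left_mem z⟩,
    ⟨J, r, μ, a, b, h⟩, main⟩
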